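/- Setting. Let $K$ be an infinite field (for instance $\mathbb{Q}$ or a number field), $\Sigma$ a finite alphabet and $\mathcal{R}=(u,\mu,v)$ a weighted automaton of dimension $d$ on $\Sigma$ over $K$: $u\in K^{1\times d}$, $v\in K^{d\times 1}$, and $\mu:\Sigma^*\to K^{d\times d}$ is a monoid morphism. A set $I\subseteq K^d$ is an *invariant* of $\mathcal{R}$ if $u\in I$ and $w\mu(a)\in I$ for all $w\in I$, $a\in\Sigma$. A set is *Z-affine* if it is a finite union of affine subspaces of $K^d$; these are the closed sets of the affine Zariski topology. The *length* of a Z-affine set is the number of its irreducible components. For an integer $c\ge 1$ let $I_c(\mathcal{R})$ be the intersection of all Z-affine invariants of $\mathcal{R}$ of length at most $c$. Algorithm 1, on input $(\mathcal{R},c)$: start with $J:=\{u\}$. While $J$ is not an invariant of $\mathcal{R}$: pick an irreducible component $A$ of $J$ and a transition matrix $M=\mu(a)$, $a\in\Sigma$, with $A M\not\subseteq J$, and put $J:=J\cup A M$; if now $\mathrm{length}(J)>c^d$, put $J:=\textsc{reduce}(J)$. Finally return $J$. Here $\textsc{reduce}(J)=J\cup\mathrm{aff}(A\cup B)$ for two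 components $A\ne B$ of $J$ found by the following search, started with $k=d$ and with the family $F$ of all $c^d+1$ components of $J$. Given a family $F$ of $c^k+1$ affine subspaces, $k\geq 1$, whose union has an affine span of dimension at most $k$, look for a subfamily $P\subseteq F$ with $|P|=c^{k-1}+1$ such that the affine span of the union of $P$ has dimension at most $k-1$; if one exists, continue with such a $P$ and $k-1$ in place of $F$ and $k$; if there is none, take any two distinct members $A, B$ of $F$. Theorem 5.1. Algorithm 1 is correct and terminates in time $O(c^{p(d)})$ for a fixed polynomial $p$, the alphabet being regarded as fixed. Precisely, there are a polynomial $p$ with natural number coefficients and a constant $C$, not depending on $K$, $\Sigma$, $\mathcal{R}$, $d$, $c$, such that for all $K$, $\Sigma$, $d$, $\mathcal{R}$ and $c\ge1$ as above: 1. whatever choices are made, a returned set $J$ is a Z-affine invariant of $\mathcal{R}$ with $J\subseteq I_c(\mathcal{R})$; 2. whatever choices are made, the algorithm never gets stuck (as long as $J$ is not an invariant, the next iteration, including $\textsc{reduce}$ if it is called, can be carried out), and it performs at most $C\cdot\max(c,2)^{p(d)}$ iterations; 3. one fixed program, the same for all $K,\Sigma,d,\mathcal{R},c$, carries out Algorithm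 1 with at most $C\,(|\Sigma|+1)\,\max(c,2)^{p(d)}$ elementary instructions. It is of the form "compute a representation of $\{u\}$; while a guard program says that the current $J$ is not an invariant, run a body program that carries out one iteration; return $J$", and Z-affine sets are represented by the list of their irreducible components, each given by a list of affinely independent points spanning it. In 3, a program is a while-program over the list structures (trees) built from $\mathrm{nil}$, field elements and pairs. Its elementary instructions, each of cost one, are: forming and decomposing pairs, the constants $\mathrm{nil}, 0, 1$, addition, multiplication, negation and inversion (with $0^{-1}=0$) of field elements, the test whether a field element is zero, and the control instructions (identity, composition, conditional, while loop), the cost of a run being the total number of instructions executed. The input is the list of $c$ (in unary), $u$, the list of the transition matrices, and $v$. -/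

import Mathlib

open scoped Matrix

/-! ### Weighted automata and their invariants -/

/-- A weighted automaton of dimension `d` on the alphabet `σ` over `K`: a row vector `u`, a monoid
morphism `μ` from words to square matrices, and a column vector `v`. -/
structure WeightedAutomaton (K : Type*) [Field K] (σ : Type*) (d : ℕ) where
  u : Fin d → K
  μ : FreeMonoid σ →* Matrix (Fin d) (Fin d) K
  v : Fin d → K

namespace WeightedAutomaton

variable {K : Type*} [Field K] {σ : Type*} {d : ℕ}

/-- The transition matrix of a letter. -/
def transition (R : WeightedAutomaton K σ d) (a : σ) : Matrix (Fin d) (Fin d) K :=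
  R.μ (FreeMonoid.of a)

/-- `I` contains the initial vector and is stable under all transition matrices
(row vectors, matrices acting on the right). -/
def IsInvariant (R : WeightedAutomaton K σ d) (I : Set (Fin d → K)) : Prop :=
  R.u ∈ I ∧ ∀ w ∈ I, ∀ a : σ, w ᵥ* R.transition a ∈ I

end WeightedAutomaton

/-! ### The affine Zariski topology on `K ^ d` -/

section ZAffine

variable {K : Type*} [Field K] {d : ℕ}

/-- Z-affine sets, the closed sets of the affine Zariski topology: finite unions of affine
subspaces. -/
def IsZAffine (S : Set (Fin d → K)) : Prop :=
  ∃ F : Finset (AffineSubspace K (Fin d → K)), S = ⋃ A ∈ F, (A : Set (Fin d → K))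

/-- Irreducibility for the affine Zariski topology. -/
def IsZIrreducible (S : Set (Fin d → K)) : Prop :=
  S.Nonempty ∧ ∀ C₁ C₂ : Set (Fin d → K), IsZAffine C₁ → IsZAffine C₂ →
    S ⊆ C₁ ∪ C₂ → S ⊆ C₁ ∨ S ⊆ C₂

/-- The irreducible components of `S`: its maximal irreducible subsets. -/
def zComponents (S : Set (Fin d → K)) : Set (Set (Fin d → K)) :=
  {A | Maximal (fun T => T ⊆ S ∧ IsZIrreducible T) A}

/-- The length of a Z-affine set: the number of its irreducible components. -/
noncomputable def zLength (S : Set (Fin d → K)) : ℕ∞ := (zComponents S).encard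

/-- The dimension of the affine span of the union of a finite family of sets. -/
noncomputable def spanDim (F : Finset (Set (Fin d → K))) : ℕ :=
  Module.finrank K (affineSpan K (⋃ A ∈ F, A)).direction

end ZAffine

/-! ### The algorithm, on the level of sets -/

section Algorithm

variable {K : Type*} [Field K] {σ : Type*} {d : ℕ}

/-- `I_c(R)`: the intersection of all Z-affine invariants of `R` of length at most `c`. -/
def invariantMeet (R : WeightedAutomaton K σ d) (c : ℕ) : Set (Fin d → K) :=
  ⋂₀ {I | IsZAffine I ∧ R.IsInvariant I ∧ zLength I ≤ c}

/-- `MergePair c k F A B`: the search of the subroutine REDUCE, started on a family `F` of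
`c ^ k + 1` affine subspaces that spans a space of dimension at most `k`, may return the pair
`A ≠ B` of members of `F`. For `k = k' + 1` it looks for a subfamily `P` with `c ^ k' + 1` members
whose affine span has dimension at most `k'`. If there is one, it goes on with such a `P`
(`descend`); if there is none, it returns any two members of `F` (`pick`). -/
inductive MergePair (c : ℕ) :
    ℕ → Finset (Set (Fin d → K)) → Set (Fin d → K) → Set (Fin d → K) → Prop
  | descend {k : ℕ} {F P : Finset (Set (Fin d → K))} {A B : Set (Fin d → K)}
      (hP : P ⊆ F) (hcard : P.card = c ^ k + 1) (hdim : spanDim P ≤ k)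
      (h : MergePair c k P A B) : MergePair c (k + 1) F A B
  | pick {k : ℕ} {F : Finset (Set (Fin d → K))} {A B : Set (Fin d → K)}
      (hnone : ∀ P ⊆ F, P.card = c ^ k + 1 → ¬ spanDim P ≤ k)
      (hA : A ∈ F) (hB : B ∈ F) (hne : A ≠ B) : MergePair c (k + 1) F A B

/-- `J'` is a possible value of `REDUCE(J)`: two components of `J`, found by the above search among
all components of `J`, are merged into their common affine span. -/
def Reduce (c : ℕ) (J J' : Set (Fin d → K)) : Prop :=
  ∃ (F : Finset (Set (Fin d → K))) (A B : Set (Fin d → K)),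
    (F : Set (Set (Fin d → K))) = zComponents J ∧ MergePair c d F A B ∧
      J' = J ∪ (affineSpan K (A ∪ B) : Set (Fin d → K))

/-- One iteration of the while loop: `J` is not an invariant; a component `A` of `J` and a
transition matrix `M` with `A M ⊄ J` are picked, `J` becomes `J ∪ A M`, and REDUCE is applied if
the length now exceeds `c ^ d`. -/
def AlgoStep (R : WeightedAutomaton K σ d) (c : ℕ) (J J' : Set (Fin d → K)) : Prop :=
  ¬ R.IsInvariant J ∧ ∃ A ∈ zComponents J, ∃ a : σ,
    ¬ (fun w => w ᵥ* R.transition a) '' A ⊆ J ∧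
    ((zLength (J ∪ (fun w => w ᵥ* R.transition a) '' A) ≤ (c ^ d : ℕ) ∧
        J' = J ∪ (fun w => w ᵥ* R.transition a) '' A) ∨
      ((c ^ d : ℕ) < zLength (J ∪ (fun w => w ᵥ* R.transition a) '' A) ∧
        Reduce c (J ∪ (fun w => w ᵥ* R.transition a) '' A) J'))

/-- `J` is the value of the variable of the algorithm after some number of iterations, for some
choices made on the way; the start value is `{u}`. -/
def AlgoReachable (R : WeightedAutomaton K σ d) (c : ℕ) (J : Set (Fin d → K)) : Prop :=
  Relation.ReflTransGen (AlgoStep R c) {R.u} J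

/-- `J` is returned by some execution of the algorithm. -/
def AlgoReturns (R : WeightedAutomaton K σ d) (c : ℕ) (J : Set (Fin d → K)) : Prop :=
  AlgoReachable R c J ∧ R.IsInvariant J

end Algorithm

/-! ### The machine model: list programs over a field, with unit cost for every instruction -/

/-- Data: trees (in particular lists) built from `nil`, field elements and pairs. -/
inductive Val (K : Type*)
  | nil : Val K
  | atom (x : K) : Val K
  | cons (x y : Val K) : Val K

/-- Programs. They do not depend on the field; each acts on one datum. -/
inductive Prog
  /-- return the input -/
  | skip
  /-- run `P`, then `Q` on its result -/
  | comp (P Q : Prog)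
  /-- the constant `nil` -/
  | nil
  /-- run `P` and `Q` on the input and form the pair of the results -/
  | cons (P Q : Prog)
  /-- first entry of a pair -/
  | head
  /-- second entry of a pair -/
  | tail
  /-- run `T` on the input; run `P` on the input if the result was `nil`, else `Q` -/
  | ite (T P Q : Prog)
  /-- as long as `T` gives a result other than `nil`, replace the datum by the result of `P` -/
  | loop (T P : Prog)
  /-- the field constants -/
  | zero
  | one
  /-- field operations on a pair of field elements, or on one (with `0⁻¹ = 0`) -/
  | add
  | mul
  | neg
  | inv
  /-- `nil` if the field element is zero, a pair otherwise -/
  | test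

/-- `Prog.Eval P x y t`: the program `P` on the input `x` terminates with the output `y` after
exactly `t` elementary instructions. -/
inductive Prog.Eval {K : Type*} [Field K] : Prog → Val K → Val K → ℕ → Prop
  | skip (x : Val K) : Eval .skip x x 1
  | comp {P Q : Prog} {x y z : Val K} {s t : ℕ} (h₁ : Eval P x y s) (h₂ : Eval Q y z t) :
      Eval (.comp P Q) x z (s + t + 1)
  | nil (x : Val K) : Eval .nil x .nil 1
  | cons {P Q : Prog} {x y z : Val K} {s t : ℕ} (h₁ : Eval P x y s) (h₂ : Eval Q x z t) :
      Eval (.cons P Q) x (.cons y z) (s + t + 1)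
  | head (x y : Val K) : Eval .head (.cons x y) x 1
  | tail (x y : Val K) : Eval .tail (.cons x y) y 1
  | ite_nil {T P Q : Prog} {x y : Val K} {s t : ℕ} (h₁ : Eval T x .nil s) (h₂ : Eval P x y t) :
      Eval (.ite T P Q) x y (s + t + 1)
  | ite_ne {T P Q : Prog} {x b y : Val K} {s t : ℕ} (h₁ : Eval T x b s) (hb : b ≠ .nil)
      (h₂ : Eval Q x y t) : Eval (.ite T P Q) x y (s + t + 1)
  | loop_nil {T P : Prog} {x : Val K} {s : ℕ} (h₁ : Eval T x .nil s) :
      Eval (.loop T P) x x (s + 1)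
  | loop_ne {T P : Prog} {x b y z : Val K} {s t r : ℕ} (h₁ : Eval T x b s) (hb : b ≠ .nil)
      (h₂ : Eval P x y t) (h₃ : Eval (.loop T P) y z r) :
      Eval (.loop T P) x z (s + t + r + 1)
  | zero (x : Val K) : Eval .zero x (.atom 0) 1
  | one (x : Val K) : Eval .one x (.atom 1) 1
  | add (a b : K) : Eval .add (.cons (.atom a) (.atom b)) (.atom (a + b)) 1
  | mul (a b : K) : Eval .mul (.cons (.atom a) (.atom b)) (.atom (a * b)) 1
  | neg (a : K) : Eval .neg (.atom a) (.atom (-a)) 1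
  | inv (a : K) : Eval .inv (.atom a) (.atom a⁻¹) 1
  | test_zero : Eval .test (.atom 0) .nil 1
  | test_ne {a : K} (ha : a ≠ 0) : Eval .test (.atom a) (.cons .nil .nil) 1

/-- Evaluation is deterministic: output and running time are determined by program and input. -/
theorem Prog.Eval.unique {K : Type*} [Field K] {P : Prog} {x y y' : Val K} {t t' : ℕ}
    (h : Prog.Eval P x y t) (h' : Prog.Eval P x y' t') : y = y' ∧ t = t' := by
  induction h generalizing y' t' with
  | comp _ _ ih₁ ih₂ =>
    cases h' with
    | comp g₁ g₂ =>
      obtain ⟨rfl, rfl⟩ := ih₁ g₁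
      obtain ⟨rfl, rfl⟩ := ih₂ g₂
      exact ⟨rfl, rfl⟩
  | cons _ _ ih₁ ih₂ =>
    cases h' with
    | cons g₁ g₂ =>
      obtain ⟨rfl, rfl⟩ := ih₁ g₁
      obtain ⟨rfl, rfl⟩ := ih₂ g₂
      exact ⟨rfl, rfl⟩
  | ite_nil _ _ ih₁ ih₂ =>
    cases h' with
    | ite_nil g₁ g₂ =>
      obtain ⟨-, rfl⟩ := ih₁ g₁
      obtain ⟨rfl, rfl⟩ := ih₂ g₂
      exact ⟨rfl, rfl⟩
    | ite_ne g₁ gb g₂ => exact absurd (ih₁ g₁).1.symm gb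
  | ite_ne _ hb _ ih₁ ih₂ =>
    cases h' with
    | ite_nil g₁ g₂ => exact absurd (ih₁ g₁).1 hb
    | ite_ne g₁ gb g₂ =>
      obtain ⟨-, rfl⟩ := ih₁ g₁
      obtain ⟨rfl, rfl⟩ := ih₂ g₂
      exact ⟨rfl, rfl⟩
  | loop_nil _ ih₁ =>
    cases h' with
    | loop_nil g₁ =>
      obtain ⟨-, rfl⟩ := ih₁ g₁
      exact ⟨rfl, rfl⟩
    | loop_ne g₁ gb g₂ g₃ => exact absurd (ih₁ g₁).1.symm gb
  | loop_ne _ hb _ _ ih₁ ih₂ ih₃ =>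
    cases h' with
    | loop_nil g₁ => exact absurd (ih₁ g₁).1 hb
    | loop_ne g₁ gb g₂ g₃ =>
      obtain ⟨-, rfl⟩ := ih₁ g₁
      obtain ⟨rfl, rfl⟩ := ih₂ g₂
      obtain ⟨rfl, rfl⟩ := ih₃ g₃
      exact ⟨rfl, rfl⟩
  | test_zero =>
    cases h' with
    | test_zero => exact ⟨rfl, rfl⟩
    | test_ne ha => exact absurd rfl ha
  | test_ne ha =>
    cases h' with
    | test_zero => exact absurd rfl ha
    | test_ne _ => exact ⟨rfl, rfl⟩
  | _ => cases h'; exact ⟨rfl, rfl⟩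

/-! ### Inputs and outputs of programs -/

section Encoding

variable {K : Type*} [Field K] {σ : Type*} {d : ℕ}

/-- A list as a datum. -/
def Val.ofList : List (Val K) → Val K
  | [] => .nil
  | x :: l => .cons x (Val.ofList l)

/-- A natural number, in unary. -/
def Val.ofNat (n : ℕ) : Val K := Val.ofList (List.replicate n .nil)

/-- A vector, as the list of its entries. -/
def Val.ofVec {n : ℕ} (x : Fin n → K) : Val K := Val.ofList (List.ofFn fun i => .atom (x i))

/-- A matrix, as the list of its rows. -/
def Val.ofMatrix (M : Matrix (Fin d) (Fin d) K) : Val K :=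
  Val.ofList (List.ofFn fun i => Val.ofVec (M i))

/-- The input of the algorithm, the number `c` and the automaton `(u, μ, v)`, where `μ` is given by
the list of the transition matrices of the letters `e 0, …, e (m - 1)`. -/
def Val.ofInput {m : ℕ} (e : Fin m ≃ σ) (R : WeightedAutomaton K σ d) (c : ℕ) : Val K :=
  Val.ofList [Val.ofNat c, Val.ofVec R.u,
    Val.ofList (List.ofFn fun i => Val.ofMatrix (R.transition (e i))), Val.ofVec R.v]

/-- `z` represents the Z-affine set `J`: it lists the irreducible components of `J` without
repetition, each given by a list of affinely independent points that spans it. -/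
def Represents (z : Val K) (J : Set (Fin d → K)) : Prop :=
  ∃ L : List (List (Fin d → K)),
    z = Val.ofList (L.map fun X => Val.ofList (X.map Val.ofVec)) ∧
    (∀ X ∈ L, AffineIndependent K X.get) ∧
    (L.map fun X => (affineSpan K {x | x ∈ X} : Set (Fin d → K))).Nodup ∧
    {A | A ∈ L.map fun X => (affineSpan K {x | x ∈ X} : Set (Fin d → K))} = zComponents J

/-- The program that computes a start value `z` of `J` with `start`, then repeats `body` on the pair
of the input and the current value as long as `guard` asks for it, and returns the final value. -/
def whileProg (start guard body : Prog) : Prog :=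
  .comp (.comp (.cons .skip start) (.loop guard body)) .tail

/-- The three programs carry out the algorithm on the input `(R, c)`: `start` computes a
representation of `{u}`; on a representation of any value `J` that can occur, `guard` decides
whether `J` is an invariant and, if it is not, `body` carries out one iteration of the loop. -/
def Implements {m : ℕ} (start guard body : Prog) (e : Fin m ≃ σ) (R : WeightedAutomaton K σ d)
    (c : ℕ) : Prop :=
  (∃ z t, start.Eval (Val.ofInput e R c) z t ∧ Represents z {R.u}) ∧
  ∀ (J : Set (Fin d → K)) (z : Val K), AlgoReachable R c J → Represents z J →
    (∃ b t, guard.Eval (.cons (Val.ofInput e R c) z) b t ∧ (b = .nil ↔ R.IsInvariant J)) ∧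
    (¬ R.IsInvariant J → ∃ z' J' t,
      body.Eval (.cons (Val.ofInput e R c) z) (.cons (Val.ofInput e R c) z') t ∧
      AlgoStep R c J J' ∧ Represents z' J')

end Encoding

/-! Correctness is a pigeonhole argument. Over an infinite field nonempty affine subspaces are
irreducible, so one that is contained in a Z-affine set lies in a single component of it. Let `I` be
an invariant with at most `c` components and `J ⊆ I`. Then `I` contains the images of the components
of `J`. Suppose the search picks its pair from a family `F` of `c ^ (k + 1) + 1` subspaces whose
span has dimension at most `k + 1`. Some component `C` of `I` contains at least `c ^ k + 1` members
of `F`. Since no such subfamily has a span of dimension at most `k`, these members already span the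
affine span of `F`, so `C` contains it, and with it the span of any two members. Hence `J` stays
inside `I` (`MergePair.affineSpan_subset`). The search cannot run down to level 0, because two
distinct nonempty subspaces span a positive dimension (`spanDim_pos`).

For termination, a merge replaces at least two components by one, so with `N = c ^ d` every
iteration ends with at most `N` components. The set grows strictly, and then the sum of `(N + 1) ^
dim A` over the components `A` grows strictly too (`IsDecomposition.chainWeight_lt`). That sum never
exceeds `N * (N + 1) ^ d`, which bounds the number of iterations for all choices.

For the running time, the search must not run through all subfamilies. If a subfamily spans a
dimension at most `k`, its span is already spanned by `k + 1` of the points that represent its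
members. So it suffices to run through all `(k + 1)`-tuples `T` of representing points and to
collect the members inside the span of `T` (`lt_spanDim_of_tuples`, `spanDim_spanSets_le`). All
other operations are list processing and Gaussian elimination.

Costs are counted through the syntax: if `S` bounds the rounds of every loop except the one over the
alphabet, the time is at most `(S + 2) ^ P.deg` times a factor `M + 1` for the alphabet
(`Prog.Runs`). The exponent is a constant of the program, and `S` can be taken as a power of `max c
2` with exponent polynomial in `d` (`sizeBound_pow`). -/

/-! ### Running times that are polynomial in a size bound -/

namespace Prog

/-- If all loops of `P` make at most `S` rounds, then `P` runs in time `(S + 2) ^ P.deg`. -/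
def deg : Prog → ℕ
  | comp P Q => deg P + deg Q + 2
  | cons P Q => deg P + deg Q + 2
  | ite T P Q => deg T + deg P + deg Q + 2
  | loop T P => deg T + deg P + 4
  | _ => 0

/-- `P` maps `x` to `y` in time `(M + 1) * (S + 2) ^ P.deg`. -/
structure Runs {K : Type*} [Field K] (S M : ℕ) (P : Prog) (x y : Val K) : Prop where
  exists_eval : ∃ t ≤ (M + 1) * (S + 2) ^ P.deg, Eval P x y t

/-- `loop T P` maps `x` to `z` in a time suitable for `n` rounds. -/
structure LoopRuns {K : Type*} [Field K] (S M n : ℕ) (T P : Prog) (x z : Val K) : Prop where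
  exists_eval : ∃ t ≤ (n + 1) * ((M + 1) * (3 * (S + 2) ^ (T.deg + P.deg))), Eval (.loop T P) x z t

end Prog

/-- A truth value as a datum. -/
noncomputable def Val.ofProp {K : Type*} (p : Prop) : Val K :=
  open Classical in if p then .cons .nil .nil else .nil

theorem Val.ofProp_eq_nil {K : Type*} {p : Prop} : (Val.ofProp p : Val K) = .nil ↔ ¬ p := by
  unfold Val.ofProp; split <;> simp_all

theorem Val.ofProp_true {K : Type*} {p : Prop} (h : p) :
    (Val.ofProp p : Val K) = .cons .nil .nil := by
  simp [Val.ofProp, h]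

theorem Val.ofProp_false {K : Type*} {p : Prop} (h : ¬ p) : (Val.ofProp p : Val K) = .nil := by
  simp [Val.ofProp, h]

theorem Val.ofList_eq_nil {K : Type*} {l : List (Val K)} : Val.ofList l = .nil ↔ l = [] := by
  cases l <;> simp [Val.ofList]

namespace Prog

variable {K : Type*} [Field K] {S M : ℕ} {P Q T L A B : Prog} {x y z a b w : Val K}

theorem Eval.runs {t : ℕ} (h : Eval P x y t) (ht : t ≤ 1) : Runs S M P x y :=
  ⟨t, ht.trans (Nat.mul_pos M.succ_pos (by positivity)), h⟩

theorem Runs.of_eq (h : Runs S M P x y) (e : y = z) : Runs S M P x z := e ▸ h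

theorem Runs.mono (h : Runs S 0 P x y) : Runs S M P x y := by
  obtain ⟨t, ht, h⟩ := h
  exact ⟨t, ht.trans (Nat.mul_le_mul_right _ (by omega)), h⟩

/-- Each of the three summands is at most `(M + 1) * (S + 2) ^ (i + j)`. The resulting factor 3 is
absorbed by two further powers of `S + 2`, which explains the `+ 2` in `deg`. -/
theorem cost_add_le {s t i j : ℕ} (hs : s ≤ (M + 1) * (S + 2) ^ i) (ht : t ≤ (M + 1) * (S + 2) ^ j) :
    s + t + 1 ≤ (M + 1) * (3 * (S + 2) ^ (i + j)) := by
  have h1 : 1 ≤ (S + 2) ^ i := Nat.one_le_pow _ _ (by omega)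
  have h2 : 1 ≤ (S + 2) ^ j := Nat.one_le_pow _ _ (by omega)
  have h3 : (S + 2) ^ i ≤ (S + 2) ^ (i + j) := Nat.pow_le_pow_right (by omega) (by omega)
  have h4 : (S + 2) ^ j ≤ (S + 2) ^ (i + j) := Nat.pow_le_pow_right (by omega) (by omega)
  have h5 := Nat.mul_le_mul_left (M + 1) h3
  have h6 := Nat.mul_le_mul_left (M + 1) h4
  have h7 := Nat.mul_le_mul (Nat.le_add_left 1 M) (h1.trans h3)
  linarith

theorem three_mul_pow_le (i : ℕ) : 3 * (S + 2) ^ i ≤ (S + 2) ^ (i + 2) := by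
  rw [pow_add, mul_comm]
  exact Nat.mul_le_mul_left _ (by nlinarith [Nat.zero_le S])

theorem cost_seq_le {s t i j : ℕ} (hs : s ≤ (M + 1) * (S + 2) ^ i)
    (ht : t ≤ (M + 1) * (S + 2) ^ j) : s + t + 1 ≤ (M + 1) * (S + 2) ^ (i + j + 2) :=
  (cost_add_le hs ht).trans (Nat.mul_le_mul_left _ (three_mul_pow_le _))

theorem Runs.skip : Runs S M .skip x x := (Eval.skip x).runs le_rfl
theorem Runs.nil : Runs S M .nil x .nil := (Eval.nil x).runs le_rfl
theorem Runs.zero : Runs S M .zero x (.atom 0) := (Eval.zero x).runs le_rfl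
theorem Runs.one : Runs S M .one x (.atom 1) := (Eval.one x).runs le_rfl
theorem Runs.head : Runs S M .head (.cons x y) x := (Eval.head x y).runs le_rfl
theorem Runs.tail : Runs S M .tail (.cons x y) y := (Eval.tail x y).runs le_rfl
theorem Runs.add {r s : K} : Runs S M .add (.cons (.atom r) (.atom s)) (.atom (r + s)) :=
  (Eval.add r s).runs le_rfl
theorem Runs.mul {r s : K} : Runs S M .mul (.cons (.atom r) (.atom s)) (.atom (r * s)) :=
  (Eval.mul r s).runs le_rfl
theorem Runs.neg {r : K} : Runs S M .neg (.atom r) (.atom (-r)) := (Eval.neg r).runs le_rfl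
theorem Runs.inv {r : K} : Runs S M .inv (.atom r) (.atom r⁻¹) := (Eval.inv r).runs le_rfl

theorem Runs.test {r : K} : Runs S M .test (.atom r) (.ofProp (r ≠ 0)) := by
  by_cases h : r = 0
  · subst h
    rw [Val.ofProp_false (by simp)]
    exact Eval.test_zero.runs le_rfl
  · rw [Val.ofProp_true h]
    exact (Eval.test_ne h).runs le_rfl

theorem Runs.comp (h₁ : Runs S M P x y) (h₂ : Runs S M Q y z) : Runs S M (.comp P Q) x z := by
  obtain ⟨s, hs, h₁⟩ := h₁
  obtain ⟨t, ht, h₂⟩ := h₂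
  exact ⟨_, cost_seq_le hs ht, .comp h₁ h₂⟩

theorem Runs.cons (h₁ : Runs S M P x y) (h₂ : Runs S M Q x z) :
    Runs S M (.cons P Q) x (.cons y z) := by
  obtain ⟨s, hs, h₁⟩ := h₁
  obtain ⟨t, ht, h₂⟩ := h₂
  exact ⟨_, cost_seq_le hs ht, .cons h₁ h₂⟩

theorem Runs.ite_nil (h₁ : Runs S M T x .nil) (h₂ : Runs S M P x y) :
    Runs S M (.ite T P Q) x y := by
  obtain ⟨s, hs, h₁⟩ := h₁
  obtain ⟨t, ht, h₂⟩ := h₂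
  refine ⟨_, (cost_seq_le hs ht).trans ?_, .ite_nil h₁ h₂⟩
  exact Nat.mul_le_mul_left _ (Nat.pow_le_pow_right (by omega) (by simp only [deg]; omega))

theorem Runs.ite_ne (h₁ : Runs S M T x b) (hb : b ≠ .nil) (h₂ : Runs S M Q x y) :
    Runs S M (.ite T P Q) x y := by
  obtain ⟨s, hs, h₁⟩ := h₁
  obtain ⟨t, ht, h₂⟩ := h₂
  refine ⟨_, (cost_seq_le hs ht).trans ?_, .ite_ne h₁ hb h₂⟩
  exact Nat.mul_le_mul_left _ (Nat.pow_le_pow_right (by omega) (by simp only [deg]; omega))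

theorem Runs.ite (h₁ : Runs S M T x b) (hP : b = .nil → Runs S M P x y)
    (hQ : b ≠ .nil → Runs S M Q x y) : Runs S M (.ite T P Q) x y := by
  by_cases h : b = .nil
  · exact Runs.ite_nil (h ▸ h₁) (hP h)
  · exact Runs.ite_ne h₁ h (hQ h)

theorem Runs.ite_prop {p : Prop} (h₁ : Runs S M T x (.ofProp p)) (hP : ¬ p → Runs S M P x y)
    (hQ : p → Runs S M Q x y) : Runs S M (.ite T P Q) x y :=
  Runs.ite h₁ (fun h => hP (Val.ofProp_eq_nil.1 h))
    (fun h => hQ (by simpa [Val.ofProp_eq_nil] using h))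

theorem LoopRuns.zero (h : Runs S M T x .nil) : LoopRuns S M 0 T P x x := by
  obtain ⟨s, hs, h⟩ := h
  refine ⟨_, ?_, .loop_nil h⟩
  have := cost_add_le (t := 0) (j := P.deg) hs (Nat.zero_le _)
  simpa using this

theorem LoopRuns.succ {n : ℕ} (h₁ : Runs S M T x b) (hb : b ≠ .nil) (h₂ : Runs S M P x y)
    (h₃ : LoopRuns S M n T P y z) : LoopRuns S M (n + 1) T P x z := by
  obtain ⟨s, hs, h₁⟩ := h₁
  obtain ⟨t, ht, h₂⟩ := h₂
  obtain ⟨r, hr, h₃⟩ := h₃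
  refine ⟨_, ?_, .loop_ne h₁ hb h₂ h₃⟩
  have := cost_add_le hs ht
  rw [Nat.add_mul (n + 1) 1, one_mul]
  omega

/-- Of the `+ 4` in the degree of a loop, two powers of `S + 2` absorb the factor 3 and two absorb
the `n + 1 ≤ S + 1` evaluations of the guard. -/
theorem LoopRuns.runs {n : ℕ} (h : LoopRuns S M n T P x y) (hn : n ≤ S) :
    Runs S M (.loop T P) x y := by
  obtain ⟨t, ht, h⟩ := h
  refine ⟨t, ht.trans ?_, h⟩
  rw [mul_left_comm]
  refine Nat.mul_le_mul_left _ ((Nat.mul_le_mul_left _ (three_mul_pow_le _)).trans ?_)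
  rw [show (Prog.loop T P).deg = T.deg + P.deg + 2 + 2 from rfl, pow_add (S + 2) (T.deg + P.deg + 2) 2,
    mul_comm]
  exact Nat.mul_le_mul_left _ (by nlinarith)

/-- A loop whose number of rounds is not bounded by `S` multiplies the running time. -/
theorem LoopRuns.runs_of_zero (h : LoopRuns S 0 M T P x y) : Runs S M (.loop T P) x y := by
  obtain ⟨t, ht, h⟩ := h
  refine ⟨t, ht.trans ?_, h⟩
  rw [zero_add, one_mul]
  refine Nat.mul_le_mul_left _ ((three_mul_pow_le _).trans ?_)
  exact Nat.pow_le_pow_right (by omega) (by simp only [deg]; omega)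

/-! ### Program combinators

Programs act on environments, nested pairs whose entries are addressed by `var`. -/

/-- The entry with number `n` of the environment. -/
def var : ℕ → Prog
  | 0 => head
  | n + 1 => comp tail (var n)

theorem Runs.var_zero : Runs S M (var 0) (.cons a x) a := Runs.head

theorem Runs.var_succ {n : ℕ} (h : Runs S M (var n) x y) : Runs S M (var (n + 1)) (.cons a x) y :=
  Runs.comp Runs.tail h

/-- Evaluate `Q` with the value of `P` as a new first entry of the environment. -/
def letIn (P Q : Prog) : Prog := comp (cons P skip) Q

theorem Runs.letIn (h₁ : Runs S M P x y) (h₂ : Runs S M Q (.cons y x) z) :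
    Runs S M (letIn P Q) x z :=
  (h₁.cons .skip).comp h₂

/-- The truth value `True`. -/
def tt : Prog := cons nil nil

theorem Runs.tt {p : Prop} (h : p) : Runs S M tt x (.ofProp p) := by
  rw [Val.ofProp_true h]
  exact Runs.nil.cons Runs.nil

theorem Runs.ff {p : Prop} (h : ¬ p) : Runs S M .nil x (.ofProp p) := by
  rw [Val.ofProp_false h]
  exact Runs.nil

/-- Negation of a truth value. -/
def not (P : Prog) : Prog := ite P tt nil

theorem Runs.not (h : Runs S M P x b) : Runs S M (not P) x (.ofProp (b = .nil)) :=
  Runs.ite h (fun h => Runs.tt h) (fun h => Runs.ff h)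

theorem Runs.not_prop {p : Prop} (h : Runs S M P x (.ofProp p)) :
    Runs S M (.not P) x (.ofProp (¬ p)) :=
  Runs.ite_prop h (fun h => Runs.tt h) (fun h => Runs.ff (by simpa using h))

/-- Fold over the list `L` with start value `A` and step `B`; the step sees the current list entry
and the accumulator as the first two entries of the environment. -/
def fold (L A B : Prog) : Prog :=
  comp (cons L (cons A skip))
    (comp (loop head (cons (comp head tail)
      (cons (comp (cons (comp head head) tail) B) (comp tail tail)))) (var 1))

/-- Induction on the unread part of the list. During the loop the datum is the unread list, the
accumulator and the environment, so `head` serves as the guard. -/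
theorem fold_loop {S' M' : ℕ} {α : Type*} {e : α → Val K} (I : List α → Val K → Prop) {l : List α}
    (hB : ∀ pre h a post, l = pre ++ h :: post → I pre a →
      ∃ a', Runs S' M' B (.cons (e h) (.cons a x)) a' ∧ I (pre ++ [h]) a') :
    ∀ (post pre : List α) (a : Val K), l = pre ++ post → I pre a →
      ∃ a', LoopRuns S' M' post.length head (cons (comp head tail)
        (cons (comp (cons (comp head head) tail) B) (comp tail tail)))
        (.cons (.ofList (post.map e)) (.cons a x)) (.cons .nil (.cons a' x)) ∧ I l a'
  | [], pre, a, hl, hI => ⟨a, .zero .head, by simpa [hl] using hI⟩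
  | h :: post, pre, a, hl, hI => by
    obtain ⟨a', h₁, h₂⟩ := hB pre h a post hl hI
    obtain ⟨a'', h₃, h₄⟩ := fold_loop I hB post (pre ++ [h]) a' (by simp [hl]) h₂
    refine ⟨a'', .succ .head (by simp [Val.ofList]) ?_ h₃, h₄⟩
    exact (Runs.head.comp .tail).cons ((((Runs.head.comp .head).cons .tail).comp h₁).cons
      (Runs.tail.comp .tail))

/-- The accumulator is described by a relation to the prefix read so far, not by a formula. This
covers folds whose result is known only up to some property, such as the choice of a pivot, and the
step need only be run on accumulators with that property. -/
theorem Runs.fold_inv {α : Type*} {e : α → Val K} {l : List α} {a₀ : Val K}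
    (I : List α → Val K → Prop) (hL : Runs S M L x (.ofList (l.map e))) (hl : l.length ≤ S)
    (hA : Runs S M A x a₀) (h₀ : I [] a₀)
    (hB : ∀ pre h a post, l = pre ++ h :: post → I pre a →
      ∃ a', Runs S M B (.cons (e h) (.cons a x)) a' ∧ I (pre ++ [h]) a') :
    ∃ a', Runs S M (fold L A B) x a' ∧ I l a' := by
  obtain ⟨a', h, hI⟩ := fold_loop I hB l [] a₀ rfl h₀
  exact ⟨a', (hL.cons (hA.cons .skip)).comp ((h.runs hl).comp (.var_succ .var_zero)), hI⟩

/-- A fold over a list whose length is counted by the factor `M`. -/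
theorem Runs.fold_inv_outer {α : Type*} {e : α → Val K} {l : List α} {a₀ : Val K}
    (I : List α → Val K → Prop) (hL : Runs S 0 L x (.ofList (l.map e)))
    (hA : Runs S 0 A x a₀) (h₀ : I [] a₀)
    (hB : ∀ pre h a post, l = pre ++ h :: post → I pre a →
      ∃ a', Runs S 0 B (.cons (e h) (.cons a x)) a' ∧ I (pre ++ [h]) a') :
    ∃ a', Runs S l.length (fold L A B) x a' ∧ I l a' := by
  obtain ⟨a', h, hI⟩ := fold_loop I hB l [] a₀ rfl h₀
  exact ⟨a', (hL.cons (hA.cons .skip)).mono.comp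
    (h.runs_of_zero.comp (.var_succ .var_zero)), hI⟩

theorem Runs.fold {α β : Type*} {e : α → Val K} {g : β → Val K} {l : List α} {f : β → α → β}
    {a : β} (hL : Runs S M L x (.ofList (l.map e))) (hl : l.length ≤ S)
    (hA : Runs S M A x (g a))
    (hB : ∀ h ∈ l, ∀ a, Runs S M B (.cons (e h) (.cons (g a) x)) (g (f a h))) :
    Runs S M (fold L A B) x (g (l.foldl f a)) := by
  obtain ⟨a', h, rfl⟩ := Runs.fold_inv (fun pre v => v = g (pre.foldl f a)) hL hl hA rfl
    (by
      rintro pre h _ post rfl rfl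
      exact ⟨_, hB h (by simp) _, by simp⟩)
  exact h

/-- The step of a simultaneous fold over two lists. -/
def fold2Step (B : Prog) : Prog :=
  cons (comp (cons head (cons (comp (var 1) (comp tail head))
    (cons (comp (var 1) head) (comp tail tail)))) B) (comp (var 1) (comp tail tail))

/-- Simultaneous fold over two lists of the same length. -/
def fold2 (L₁ L₂ A B : Prog) : Prog := comp (fold L₁ (cons A L₂) (fold2Step B)) head

theorem Runs.fold2 {L₂ : Prog} {α α' β : Type*} {e : α → Val K} {e' : α' → Val K} {g : β → Val K}
    {l : List α} {l' : List α'} {f : β → α → α' → β} {a : β}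
    (hL : Runs S M L x (.ofList (l.map e))) (hL₂ : Runs S M L₂ x (.ofList (l'.map e')))
    (hl : l.length ≤ S) (hll : l.length = l'.length) (hA : Runs S M A x (g a))
    (hB : ∀ h ∈ l, ∀ h' ∈ l', ∀ a,
      Runs S M B (.cons (e h) (.cons (e' h') (.cons (g a) x))) (g (f a h h'))) :
    Runs S M (fold2 L L₂ A B) x (g ((l.zip l').foldl (fun a h => f a h.1 h.2) a)) := by
  -- The accumulator carries the unread part `post'` of the second list along with the value of the
  -- fold.
  obtain ⟨a', h, b, post', h₁, h₂, h₃, rfl⟩ := Runs.fold_inv (e := e)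
    (fun pre v => ∃ pre' post', l' = pre' ++ post' ∧ pre'.length = pre.length ∧
      v = .cons (g ((pre.zip pre').foldl (fun a h => f a h.1 h.2) a)) (.ofList (post'.map e')))
    hL hl (hA.cons hL₂) ⟨[], l', by simp⟩
    (B := fold2Step B)
    (by
      rintro pre h _ post rfl ⟨pre', post', rfl, hlen, rfl⟩
      cases post' with
      | nil => simp at hll; omega
      | cons h' post' =>
        refine ⟨_, ((Runs.head.cons (((Runs.var_succ .var_zero).comp (Runs.tail.comp .head)).cons
          (((Runs.var_succ .var_zero).comp .head).cons (Runs.tail.comp .tail)))).comp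
          (hB h (by simp) h' (by simp) _)).cons
          ((Runs.var_succ .var_zero).comp (Runs.tail.comp .tail)),
          pre' ++ [h'], post', by simp, by simp [hlen], ?_⟩
        rw [List.zip_append hlen.symm]
        simp)
  refine (h.comp .head).of_eq ?_
  have : post' = [] := by
    have := congrArg List.length h₁
    simp at this
    exact List.length_eq_zero_iff.1 (by omega)
  subst this
  rw [h₁, List.append_nil]

/-- Reversal of a list. -/
def reverse (L : Prog) : Prog := fold L nil (cons head (var 1))

theorem Runs.reverse {α : Type*} {e : α → Val K} {l : List α}
    (hL : Runs S M L x (.ofList (l.map e))) (hl : l.length ≤ S) :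
    Runs S M (reverse L) x (.ofList (l.reverse.map e)) := by
  have := Runs.fold (A := .nil) (B := .cons .head (var 1)) (a := [])
    (g := fun l : List α => Val.ofList (l.map e))
    (f := fun a h => h :: a) hL hl .nil (fun h _ a => Runs.head.cons (.var_succ .var_zero))
  simpa [Prog.reverse] using this

/-- Is `B` true for all entries of the list `L`? -/
def all (L B : Prog) : Prog := fold L tt (ite (var 1) nil (comp (cons head (comp tail tail)) B))

theorem all_step {α : Type*} {e : α → Val K} {p : α → Prop} {pre : List α} {h : α}
    (hB : Runs S M B (.cons (e h) x) (.ofProp (p h))) :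
    Runs S M (.ite (var 1) .nil (.comp (.cons .head (.comp .tail .tail)) B))
      (.cons (e h) (.cons (.ofProp (∀ h ∈ pre, p h)) x)) (.ofProp (∀ k ∈ pre ++ [h], p k)) := by
  refine Runs.ite_prop (.var_succ .var_zero) (fun hp => .ff fun h' => hp fun k hk => h' k (by simp [hk]))
    fun hp => ?_
  refine (((Runs.head).cons (Runs.tail.comp .tail)).comp hB).of_eq (congrArg _ ?_)
  simp only [List.mem_append, List.mem_singleton, or_imp, forall_and, forall_eq]
  exact propext ⟨fun h => ⟨hp, h⟩, fun h => h.2⟩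

theorem Runs.all {α : Type*} {e : α → Val K} {l : List α} {p : α → Prop}
    (hL : Runs S M L x (.ofList (l.map e))) (hl : l.length ≤ S)
    (hB : ∀ h ∈ l, Runs S M B (.cons (e h) x) (.ofProp (p h))) :
    Runs S M (all L B) x (.ofProp (∀ h ∈ l, p h)) := by
  obtain ⟨a', h, rfl⟩ := Runs.fold_inv (fun pre v => v = .ofProp (∀ h ∈ pre, p h)) hL hl
    (.tt (p := ∀ h ∈ [], p h) (by simp)) rfl
    (by
      rintro pre h _ post rfl rfl
      exact ⟨_, all_step (hB h (by simp)), rfl⟩)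
  exact h

/-- Is `B` true for some entry of the list `L`? -/
def any (L B : Prog) : Prog := not (all L (not B))

theorem Runs.any {α : Type*} {e : α → Val K} {l : List α} {p : α → Prop}
    (hL : Runs S M L x (.ofList (l.map e))) (hl : l.length ≤ S)
    (hB : ∀ h ∈ l, Runs S M B (.cons (e h) x) (.ofProp (p h))) :
    Runs S M (any L B) x (.ofProp (∃ h ∈ l, p h)) :=
  (Runs.not_prop (Runs.all hL hl fun h hh => (hB h hh).not_prop)).of_eq (by simp)

/-- The list of the values of `B` at the entries of the list `L`. -/
def map (L B : Prog) : Prog :=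
  reverse (fold L nil (cons (comp (cons head (comp tail tail)) B) (var 1)))

theorem Runs.map {α β : Type*} {e : α → Val K} {e' : β → Val K} {l : List α} {f : α → β}
    (hL : Runs S M L x (.ofList (l.map e))) (hl : l.length ≤ S)
    (hB : ∀ h ∈ l, Runs S M B (.cons (e h) x) (e' (f h))) :
    Runs S M (map L B) x (.ofList ((l.map f).map e')) := by
  have := Runs.fold (A := .nil) (B := .cons (.comp (.cons .head (.comp .tail .tail)) B) (var 1))
    (a := []) (g := fun l : List β => Val.ofList (l.map e'))
    (f := fun a h => f h :: a) hL hl .nil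
    (fun h hh a => ((Runs.head.cons (Runs.tail.comp .tail)).comp (hB h hh)).cons
      (.var_succ .var_zero))
  have h2 : l.foldl (fun a h => f h :: a) [] = (l.map f).reverse := by
    simp
  rw [h2] at this
  simpa [Prog.map] using this.reverse (by simpa using hl)

/-- The entries of the list `L` at which `B` is true, in reversed order. -/
def filter (L B : Prog) : Prog :=
  fold L nil (ite (comp (cons head (comp tail tail)) B) (var 1) (cons head (var 1)))

open Classical in
theorem Runs.filter {α : Type*} {e : α → Val K} {l : List α} {p : α → Prop}
    (hL : Runs S M L x (.ofList (l.map e))) (hl : l.length ≤ S)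
    (hB : ∀ h ∈ l, Runs S M B (.cons (e h) x) (.ofProp (p h))) :
    Runs S M (filter L B) x (.ofList ((l.filter fun h => p h).reverse.map e)) := by
  have := Runs.fold (A := .nil)
    (B := .ite (.comp (.cons .head (.comp .tail .tail)) B) (var 1) (.cons .head (var 1)))
    (a := []) (g := fun l : List α => Val.ofList (l.map e))
    (f := fun a h => if p h then h :: a else a) hL hl .nil
    (fun h hh a => Runs.ite_prop ((Runs.head.cons (Runs.tail.comp .tail)).comp (hB h hh))
      (fun hp => by rw [if_neg hp]; exact .var_succ .var_zero)
      (fun hp => by rw [if_pos hp]; exact Runs.head.cons (.var_succ .var_zero)))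
  have h2 : ∀ (l a : List α), l.foldl (fun a h => if p h then h :: a else a) a =
      (l.filter fun h => p h).reverse ++ a := by
    intro l
    induction l with
    | nil => simp
    | cons h l ih =>
      intro a
      by_cases hp : p h <;> simp [ih, hp]
  simpa [h2, Prog.filter] using this

/-- The list `L`, reversed, followed by the list `A`. -/
def appendRev (L A : Prog) : Prog := fold L A (cons head (var 1))

theorem Runs.appendRev {α : Type*} {e : α → Val K} {l l' : List α}
    (hL : Runs S M L x (.ofList (l.map e))) (hA : Runs S M A x (.ofList (l'.map e)))
    (hl : l.length ≤ S) :
    Runs S M (appendRev L A) x (.ofList ((l.reverse ++ l').map e)) := by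
  have := Runs.fold (A := A) (B := .cons .head (var 1)) (a := l')
    (g := fun l : List α => Val.ofList (l.map e))
    (f := fun a h => h :: a) hL hl hA (fun h _ a => Runs.head.cons (.var_succ .var_zero))
  simpa [Prog.appendRev] using this

/-- Drop as many entries from the list `L` as `A` has. -/
def drop (L A : Prog) : Prog := fold A L (ite (var 1) nil (comp (var 1) tail))

theorem Runs.drop {α β : Type*} {e : α → Val K} {e' : β → Val K} {l : List α} {l' : List β}
    (hL : Runs S M L x (.ofList (l.map e))) (hA : Runs S M A x (.ofList (l'.map e')))
    (hl' : l'.length ≤ S) :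
    Runs S M (drop L A) x (.ofList ((l.drop l'.length).map e)) := by
  have := Runs.fold (A := L) (B := .ite (var 1) .nil (.comp (var 1) .tail)) (a := l)
    (g := fun l : List α => Val.ofList (l.map e))
    (f := fun a h => a.tail) hA hl' hL (fun h _ a => by
      cases a with
      | nil => exact Runs.ite_nil (.var_succ .var_zero) .nil
      | cons k a =>
        exact Runs.ite_ne (.var_succ .var_zero) (by simp [Val.ofList])
          ((Runs.var_succ .var_zero).comp .tail))
  have h2 : ∀ (l' : List β) (a : List α), l'.foldl (fun a _ => a.tail) a = a.drop l'.length := by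
    intro l'
    induction l' with
    | nil => simp
    | cons h l ih => intro a; simp [ih]
  simpa [h2, Prog.drop] using this

end Prog

/-! ### Vectors and matrices -/

theorem Val.ofVec_eq {K : Type*} [Field K] {n : ℕ} (x : Fin n → K) :
    Val.ofVec x = Val.ofList ((List.ofFn x).map Val.atom) := by
  rw [List.map_ofFn]; rfl

theorem Val.ofVec_succ {K : Type*} [Field K] {n : ℕ} (x : Fin (n + 1) → K) :
    Val.ofVec x = Val.cons (.atom (x 0)) (Val.ofVec (Fin.tail x)) := by
  simp only [Val.ofVec, List.ofFn_succ, Val.ofList]; rfl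

theorem Val.ofVec_cons {K : Type*} [Field K] {n : ℕ} (a : K) (x : Fin n → K) :
    Val.ofVec (Matrix.vecCons a x) = Val.cons (.atom a) (Val.ofVec x) := by
  rw [Val.ofVec_succ]; rfl

theorem Val.ofVec_zero {K : Type*} [Field K] (x : Fin 0 → K) : Val.ofVec x = Val.nil := rfl

/-- A list of points as a datum. -/
def Val.ofPts {K : Type*} [Field K] {n : ℕ} (X : List (Fin n → K)) : Val K :=
  Val.ofList (X.map Val.ofVec)

namespace Prog

variable {K : Type*} [Field K] {S M : ℕ} {P Q T L A B : Prog} {x y z a b w : Val K} {n : ℕ}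

theorem Runs.var_one : Runs S M (var 1) (.cons a (.cons b x)) b := .var_succ .var_zero
theorem Runs.var_two : Runs S M (var 2) (.cons a (.cons b (.cons w x))) w := .var_succ .var_one
theorem Runs.var_three : Runs S M (var 3) (.cons a (.cons b (.cons w (.cons z x)))) z :=
  .var_succ .var_two
theorem Runs.var_four : Runs S M (var 4) (.cons a (.cons b (.cons w (.cons z (.cons y x))))) y :=
  .var_succ .var_three

/-- `a + t b` for the environment `t, a, b`. -/
def axpy : Prog :=
  reverse (fold2 (var 1) (var 2) nil
    (cons (comp (cons (var 0) (comp (cons (var 3) (var 1)) mul)) add) (var 2)))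

theorem Runs.axpy {t : K} {u v : Fin n → K} (hn : n ≤ S) :
    Runs S M axpy (.cons (.atom t) (.cons (.ofVec u) (.cons (.ofVec v) .nil)))
      (.ofVec (u + t • v)) := by
  have h := Runs.fold2 (S := S) (M := M) (L := var 1) (L₂ := var 2) (A := .nil)
    (x := .cons (.atom t) (.cons (.ofVec u) (.cons (.ofVec v) .nil)))
    (B := .cons (.comp (.cons (var 0) (.comp (.cons (var 3) (var 1)) .mul)) .add) (var 2))
    (e := Val.atom) (e' := Val.atom) (g := fun l : List K => Val.ofList (l.map Val.atom))
    (l := List.ofFn u) (l' := List.ofFn v) (a := [])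
    (f := fun a h h' => (h + t * h') :: a)
    (by rw [← Val.ofVec_eq]; exact .var_one) (by rw [← Val.ofVec_eq]; exact .var_two)
    (by simpa using hn) (by simp) .nil
    (fun h _ h' _ a => ((Runs.var_zero.cons ((Runs.var_three.cons .var_one).comp .mul)).comp
      .add).cons .var_two)
  have h2 : ((List.ofFn u).zip (List.ofFn v)).foldl (fun a h => (h.1 + t * h.2) :: a) [] =
      (List.ofFn (u + t • v)).reverse := by
    have : ((List.ofFn u).zip (List.ofFn v)).map (fun h => h.1 + t * h.2) =
        List.ofFn (u + t • v) := by
      apply List.ext_getElem <;> simp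
    rw [← this]
    simp
  rw [h2] at h
  have h3 := h.reverse (by simpa using hn)
  rw [List.reverse_reverse, ← Val.ofVec_eq] at h3
  exact h3

/-- `x M` for the environment `x, M`. -/
def vecMul : Prog :=
  fold2 (var 0) (var 1) (map (var 0) zero) (comp (cons (var 0) (cons (var 2) (cons (var 1) nil))) axpy)

theorem Runs.vecMul {u : Fin n → K} {N : Matrix (Fin n) (Fin n) K} (hn : n ≤ S) :
    Runs S M vecMul (.cons (.ofVec u) (.cons (.ofMatrix N) .nil)) (.ofVec (u ᵥ* N)) := by
  have h0 (v : Val K) : Runs S M (.map (var 0) .zero) (.cons (.ofVec u) v)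
      (.ofVec (0 : Fin n → K)) := by
    have := Runs.map (S := S) (M := M) (L := var 0) (B := .zero) (e := Val.atom) (e' := Val.atom)
      (x := .cons (.ofVec u) v)
      (l := List.ofFn u) (f := fun _ => 0) (by rw [← Val.ofVec_eq]; exact .var_zero)
      (by simpa using hn) (fun _ _ => .zero)
    refine this.of_eq ?_
    rw [Val.ofVec_eq]
    congr 2
    apply List.ext_getElem <;> simp
  refine (Runs.fold2 (e := Val.atom) (e' := Val.ofVec) (g := fun v : Fin n → K => Val.ofVec v)
    (l := List.ofFn u) (l' := List.ofFn N.row) (a := 0) (f := fun a h h' => a + h • h')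
    (by rw [← Val.ofVec_eq]; exact .var_zero) ?_ (by simpa using hn) (by simp) (h0 _)
    (fun h _ h' _ a => (Runs.var_zero.cons (Runs.var_two.cons (Runs.var_one.cons .nil))).comp
      (.axpy hn))).of_eq ?_
  · rw [List.map_ofFn]
    exact Runs.var_one
  · congr 1
    -- The fold adds up the rows of `N` weighted by the entries of `u`.
    rw [← List.foldl_map (f := fun h : K × (Fin n → K) => h.1 • h.2) (g := fun a b => a + b),
      ← List.sum_eq_foldl]
    have : ((List.ofFn u).zip (List.ofFn N.row)).map (fun h => h.1 • h.2) =
        List.ofFn fun i => u i • N.row i := by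
      apply List.ext_getElem <;> simp
    rw [this, List.sum_ofFn]
    ext j
    simp [Matrix.vecMul, dotProduct]

end Prog

/-! ### Membership in a linear or affine span -/

section Elimination

variable {K : Type*} [Field K] {n : ℕ}

/-- Elimination of the first coordinate by means of `v`. -/
def eliminate (v : Fin (n + 1) → K) : (Fin (n + 1) → K) →ₗ[K] (Fin n → K) where
  toFun x := Fin.tail x + (x 0 * -(v 0)⁻¹) • Fin.tail v
  map_add' x y := by
    ext i
    simp [Fin.tail]
    ring
  map_smul' c x := by
    ext i
    simp [Fin.tail]
    ring

/-- The kernel of `eliminate v` consists of multiples of `v`, hence lies in the span of `s`, and so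
membership in that span can be tested on images. -/
theorem mem_span_iff_eliminate {v : Fin (n + 1) → K} (hv : v 0 ≠ 0) {s : Set (Fin (n + 1) → K)}
    (hs : v ∈ s) (x : Fin (n + 1) → K) :
    x ∈ Submodule.span K s ↔ eliminate v x ∈ Submodule.span K (eliminate v '' s) := by
  rw [← Submodule.map_span, ← Submodule.mem_comap, Submodule.comap_map_eq, sup_eq_left.2]
  intro y hy
  -- For `y` in the kernel, the vanishing of the remaining coordinates says exactly that `y` is this
  -- multiple of the pivot.
  have : y = (y 0 * (v 0)⁻¹) • v := by
    ext i
    refine Fin.cases ?_ (fun i => ?_) i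
    · simp [hv]
    · have := congrFun (LinearMap.mem_ker.1 hy) i
      simp [eliminate, Fin.tail] at this
      simp
      linear_combination this
  rw [this]
  exact Submodule.smul_mem _ _ (Submodule.subset_span hs)

/-- The case without a pivot: the first coordinate becomes a condition on `x` alone, which the
elimination stores in its flag. -/
theorem mem_span_iff_tail {s : Set (Fin (n + 1) → K)} (hs : ∀ v ∈ s, v 0 = 0)
    (x : Fin (n + 1) → K) :
    x ∈ Submodule.span K s ↔ x 0 = 0 ∧ Fin.tail x ∈ Submodule.span K (Fin.tail '' s) := by
  let f : (Fin (n + 1) → K) →ₗ[K] (Fin n → K) := LinearMap.funLeft K K Fin.succ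
  have hf : (Fin.tail : (Fin (n + 1) → K) → (Fin n → K)) = f := rfl
  have h0 : ∀ y ∈ Submodule.span K s, y 0 = 0 := by
    intro y hy
    have : Submodule.span K s ≤ LinearMap.ker (LinearMap.proj 0 : (Fin (n + 1) → K) →ₗ[K] K) :=
      Submodule.span_le.2 fun v hv => by simpa using hs v hv
    simpa using this hy
  rw [hf, ← Submodule.map_span]
  refine ⟨fun h => ⟨h0 x h, Submodule.mem_map_of_mem h⟩, ?_⟩
  rintro ⟨hx, y, hy, hyx⟩
  have : x = y := by
    ext i
    refine Fin.cases ?_ (fun i => ?_) i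
    · rw [hx, h0 y hy]
    · exact (congrFun hyx i).symm
  rwa [this]

/-- Homogenization: a linear combination of the vectors `(1, p)` has first coordinate 1 exactly when
its coefficients add up to 1. -/
theorem mem_affineSpan_iff_mem_span_cons {s : Set (Fin n → K)} {x : Fin n → K} :
    x ∈ affineSpan K s ↔
      Matrix.vecCons 1 x ∈ Submodule.span K (Matrix.vecCons 1 '' s) := by
  let f : (Fin n → K) →ᵃ[K] (Fin (n + 1) → K) :=
    { toFun := Matrix.vecCons 1
      linear :=
        { toFun := Matrix.vecCons 0
          map_add' := by simp
          map_smul' := by simp }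
      map_vadd' := by simp }
  constructor
  · intro h
    have : affineSpan K s ≤ (Submodule.span K (Matrix.vecCons 1 '' s)).toAffineSubspace.comap f :=
      affineSpan_le.2 fun y hy => Submodule.subset_span ⟨y, hy, rfl⟩
    exact this h
  · intro h
    -- A form of the converse that is linear in `y` and hence open to induction on the span; it is
    -- then applied to `y = (1, x)`.
    have key : ∀ y ∈ Submodule.span K (Matrix.vecCons 1 '' s),
        ∀ p ∈ s, Fin.tail y - y 0 • p ∈ (affineSpan K s).direction := by
      intro y hy p hp
      induction hy using Submodule.span_induction with
      | mem y hy =>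
        obtain ⟨z, hz, rfl⟩ := hy
        simpa using AffineSubspace.vsub_mem_direction (mem_affineSpan K hz) (mem_affineSpan K hp)
      | zero =>
        convert zero_mem (affineSpan K s).direction using 1
        ext i
        simp [Fin.tail]
      | add y z _ _ h1 h2 =>
        convert add_mem h1 h2 using 1
        ext i
        simp [Fin.tail]
        ring
      | smul c y _ h1 =>
        convert Submodule.smul_mem _ c h1 using 1
        ext i
        simp [Fin.tail]
        ring
    rcases s.eq_empty_or_nonempty with rfl | ⟨p, hp⟩
    · simp at h
    · have := AffineSubspace.vadd_mem_of_mem_direction (key _ h p hp) (mem_affineSpan K hp)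
      simpa using this

end Elimination

namespace Prog

variable {K : Type*} [Field K] {S M : ℕ} {P Q T L A B : Prog} {x y z a b w : Val K} {n : ℕ}

/-- The elimination step when the list of vectors has an entry `v` with nonzero first coordinate,
for the environment `-1 / v 0, v, p, V, ok`. -/
def elimPivot : Prog :=
  cons (comp (cons (comp (cons (comp (var 2) head) (var 0)) mul)
      (cons (comp (var 2) tail) (cons (comp (var 1) tail) nil))) axpy)
    (cons (map (var 3) (comp (cons (comp (cons (comp (var 0) head) (var 1)) mul)
      (cons (comp (var 0) tail) (cons (comp (var 2) tail) nil))) axpy)) (cons (var 4) nil))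

/-- The elimination step when the first coordinates of all vectors are zero, for the environment
`nil, p, V, ok`. -/
def elimNoPivot : Prog :=
  cons (comp (var 1) tail) (cons (map (var 2) (comp (var 0) tail))
    (cons (ite (comp (comp (var 1) head) test) (var 3) nil) nil))

/-- An entry of `V` with nonzero first coordinate, if there is one, for the environment `p, V`. -/
def pivot : Prog := fold (var 1) nil (ite (comp (comp (var 0) head) test) (var 1) (var 0))

/-- Elimination of one coordinate for the environment `p, V, ok`. -/
def elimStep : Prog :=
  letIn pivot (ite (var 0) elimNoPivot
      (letIn (comp (comp (comp (var 0) head) inv) neg) elimPivot))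

/-- Is `p` in the linear span of the list `V`, for the environment `p, V`? -/
def linMem : Prog :=
  comp (cons (var 0) (cons (var 1) (cons tt nil))) (comp (loop head elimStep) (var 2))

/-- Is `p` in the affine span of the list `X`, for the environment `p, X`? -/
def affMem : Prog :=
  comp (cons (cons one (var 0)) (cons (map (var 1) (cons one (var 0))) nil)) linMem

theorem Runs.pivot {V : List (Fin (n + 1) → K)} (hV : V.length ≤ S) :
    ∃ a, Runs S M Prog.pivot (.cons y (.cons (.ofPts V) x)) a ∧
      ((a = .nil ∧ ∀ v ∈ V, v 0 = 0) ∨ ∃ v ∈ V, v 0 ≠ 0 ∧ a = .ofVec v) := by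
  refine Runs.fold_inv (e := Val.ofVec) (fun pre a => (a = .nil ∧ ∀ v ∈ pre, v 0 = 0) ∨
    ∃ v ∈ pre, v 0 ≠ 0 ∧ a = .ofVec v) .var_one hV .nil (by simp) ?_
  intro pre h a post hl hI
  have ht : Runs S M (.comp (.comp (var 0) .head) .test)
      (.cons (.ofVec h) (.cons a (.cons y (.cons (.ofPts V) x)))) (.ofProp (h 0 ≠ 0)) := by
    rw [Val.ofVec_succ]
    exact (Runs.var_zero.comp .head).comp .test
  by_cases h0 : h 0 = 0
  · refine ⟨a, Runs.ite_prop ht (fun _ => .var_one) (fun h => absurd h0 h), ?_⟩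
    rcases hI with ⟨rfl, hI⟩ | ⟨v, hv, hI⟩
    · refine .inl ⟨rfl, fun v hv => ?_⟩
      rcases List.mem_append.1 hv with hv | hv
      · exact hI v hv
      · rwa [List.mem_singleton.1 hv]
    · exact .inr ⟨v, by simp [hv], hI⟩
  · exact ⟨_, Runs.ite_prop ht (fun h => absurd h0 h) (fun _ => .var_zero),
      .inr ⟨h, by simp, h0, rfl⟩⟩

/-- The invariant is the conjunction of flag and membership. With a pivot the flag is unchanged;
without one it also records whether the first coordinate of `p` vanishes. -/
theorem Runs.elimStep {V : List (Fin (n + 1) → K)} {p : Fin (n + 1) → K} {q : Prop}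
    (hV : V.length ≤ S) (hn : n ≤ S) :
    ∃ (V' : List (Fin n → K)) (p' : Fin n → K) (q' : Prop), V'.length = V.length ∧
      Runs S M elimStep (.cons (.ofVec p) (.cons (.ofPts V) (.cons (.ofProp q) .nil)))
        (.cons (.ofVec p') (.cons (.ofPts V') (.cons (.ofProp q') .nil))) ∧
      ((q ∧ p ∈ Submodule.span K {v | v ∈ V}) ↔ (q' ∧ p' ∈ Submodule.span K {v | v ∈ V'})) := by
  obtain ⟨a, ha, ⟨rfl, h0⟩ | ⟨v, hv, hv0, rfl⟩⟩ :=
    Runs.pivot (M := M) (y := .ofVec p) (x := .cons (.ofProp q) .nil) hV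
  · refine ⟨V.map Fin.tail, Fin.tail p, q ∧ p 0 = 0, by simp, ha.letIn (Runs.ite_nil .var_zero ?_), ?_⟩
    · refine Runs.cons ?_ (Runs.cons ?_ (Runs.cons ?_ .nil))
      · rw [Val.ofVec_succ]
        exact Runs.var_one.comp .tail
      · refine Runs.map .var_two hV fun v _ => ?_
        rw [Val.ofVec_succ]
        exact Runs.var_zero.comp .tail
      · refine Runs.ite_prop (p := p 0 ≠ 0) ?_ (fun h => ?_) (fun h => .ff fun h' => h h'.2)
        · rw [Val.ofVec_succ]
          exact (Runs.var_one.comp .head).comp .test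
        · exact Runs.var_three.of_eq (congrArg _ (propext ⟨fun hq => ⟨hq, not_not.1 h⟩, fun hq => hq.1⟩))
    · rw [mem_span_iff_tail (s := {v | v ∈ V}) h0, and_assoc]
      simp [Set.image]
  · refine ⟨V.map (eliminate v), eliminate v p, q, by simp,
      ha.letIn (Runs.ite_ne .var_zero (by simp [Val.ofVec_succ])
        (Runs.letIn (y := .atom (-(v 0)⁻¹)) ?_
        (Runs.cons ?_ (Runs.cons ?_ (Runs.var_four.cons .nil))))), ?_⟩
    · rw [Val.ofVec_succ v]
      exact ((Runs.var_zero.comp .head).comp .inv).comp .neg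
    · rw [Val.ofVec_succ p, Val.ofVec_succ v]
      exact ((((Runs.var_two.comp .head).cons .var_zero).comp .mul).cons
        ((Runs.var_two.comp .tail).cons ((Runs.var_one.comp .tail).cons .nil))).comp (.axpy hn)
    · refine Runs.map .var_three hV fun w _ => ?_
      rw [Val.ofVec_succ w, Val.ofVec_succ v]
      exact ((((Runs.var_zero.comp .head).cons .var_one).comp .mul).cons
        ((Runs.var_zero.comp .tail).cons ((Runs.var_two.comp .tail).cons .nil))).comp (.axpy hn)
    · rw [mem_span_iff_eliminate hv0 (s := {v | v ∈ V}) hv]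
      simp [Set.image]

/-- The shrinking vector `p` serves as the loop counter. Once no coordinates are left, membership
holds trivially and the flag is the answer. -/
theorem elimLoop : ∀ {n : ℕ} {V : List (Fin n → K)} {p : Fin n → K} {q : Prop}
    (_ : V.length ≤ S) (_ : n ≤ S), ∃ (v : Val K), LoopRuns S M n .head elimStep
      (.cons (.ofVec p) (.cons (.ofPts V) (.cons (.ofProp q) .nil)))
      (.cons .nil (.cons v (.cons (.ofProp (q ∧ p ∈ Submodule.span K {v | v ∈ V})) .nil)))
  | 0, V, p, q, _, _ => by
    refine ⟨.ofPts V, ?_⟩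
    have : (q ∧ p ∈ Submodule.span K {v | v ∈ V}) = q := by
      rw [Subsingleton.elim p 0]; exact propext ⟨fun h => h.1, fun h => ⟨h, zero_mem _⟩⟩
    rw [this, Val.ofVec_zero]
    exact .zero .head
  | n + 1, V, p, q, hV, hn => by
    obtain ⟨V', p', q', hlen, h, hiff⟩ := Runs.elimStep (M := M) (p := p) (q := q) hV (by omega)
    obtain ⟨v, hloop⟩ := elimLoop (V := V') (p := p') (q := q') (by omega) (by omega)
    exact ⟨v, .succ .head (by simp [Val.ofVec_succ]) h (by rwa [propext hiff])⟩

theorem Runs.linMem {V : List (Fin n → K)} {p : Fin n → K} (hV : V.length ≤ S) (hn : n ≤ S) :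
    Runs S M linMem (.cons (.ofVec p) (.cons (.ofPts V) x))
      (.ofProp (p ∈ Submodule.span K {v | v ∈ V})) := by
  obtain ⟨v, h⟩ := elimLoop (M := M) (p := p) (q := True) hV hn
  have := (Runs.var_zero.cons (Runs.var_one.cons (Runs.cons (.tt trivial) .nil))).comp
    ((h.runs hn).comp .var_two) (x := .cons (.ofVec p) (.cons (.ofPts V) x))
  simpa [Prog.linMem] using this

/-- The bound on `n` is strict because homogenization adds a coordinate. -/
theorem Runs.affMem {X : List (Fin n → K)} {p : Fin n → K} (hX : X.length ≤ S) (hn : n < S) :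
    Runs S M affMem (.cons (.ofVec p) (.cons (.ofPts X) x))
      (.ofProp (p ∈ affineSpan K {v | v ∈ X})) := by
  have h1 : Runs S M (.map (var 1) (.cons .one (var 0))) (.cons (.ofVec p) (.cons (.ofPts X) x))
      (.ofPts (X.map (Matrix.vecCons 1))) :=
    Runs.map .var_one hX fun y _ => by
      rw [Val.ofVec_cons]
      exact Runs.one.cons .var_zero
  have h2 : Runs S M (.cons .one (var 0)) (.cons (.ofVec p) (.cons (.ofPts X) x))
      (.ofVec (Matrix.vecCons 1 p)) := by
    rw [Val.ofVec_cons]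
    exact Runs.one.cons .var_zero
  refine ((h2.cons (h1.cons .nil)).comp (.linMem (by simpa using hX) hn)).of_eq ?_
  rw [mem_affineSpan_iff_mem_span_cons]
  simp [Set.image]

end Prog

/-! ### The affine Zariski topology -/

section Zariski

variable {K : Type*} [Field K] {d : ℕ}

theorem AffineSubspace.lineMap_mem_of_ne {A : AffineSubspace K (Fin d → K)} {x y : Fin d → K}
    {s t : K} (hst : s ≠ t) (hs : AffineMap.lineMap x y s ∈ A) (ht : AffineMap.lineMap x y t ∈ A)
    (r : K) : AffineMap.lineMap x y r ∈ A := by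
  have := AffineMap.lineMap_mem ((r - s) / (t - s)) hs ht
  convert this using 1
  have h : t - s ≠ 0 := sub_ne_zero.2 hst.symm
  ext i
  simp only [AffineMap.lineMap_apply, vsub_eq_sub, vadd_eq_add, Pi.add_apply, Pi.smul_apply,
    Pi.sub_apply, smul_eq_mul]
  field_simp
  ring

/-- Nonempty affine subspaces over an infinite field are irreducible. -/
theorem AffineSubspace.isZIrreducible [Infinite K] (A : AffineSubspace K (Fin d → K))
    (hA : (A : Set (Fin d → K)).Nonempty) : IsZIrreducible (A : Set (Fin d → K)) := by
  classical
  refine ⟨hA, ?_⟩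
  rintro _ _ ⟨F₁, rfl⟩ ⟨F₂, rfl⟩ hsub
  by_contra! h
  obtain ⟨⟨x, hx, hx₁⟩, ⟨y, hy, hy₂⟩⟩ := And.imp Set.not_subset.1 Set.not_subset.1 h
  -- The line through `x` and `y` lies in `A`. A member of `F₁` or `F₂` that meets it for two
  -- parameters contains all of it, in particular `x` (parameter 0) and `y` (parameter 1), contrary
  -- to the choice of these points. So finitely many parameters would exhaust `K`.
  refine Set.infinite_univ (α := K) (Set.Finite.subset (s := ⋃ B ∈ F₁ ∪ F₂,
    {t : K | AffineMap.lineMap x y t ∈ B}) ?_ ?_)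
  · refine Set.Finite.biUnion (Finset.finite_toSet _) fun B hB => Set.Subsingleton.finite ?_
    intro s hs t ht
    by_contra hst
    have := AffineSubspace.lineMap_mem_of_ne hst hs ht
    rcases Finset.mem_union.1 hB with hB | hB
    · exact hx₁ (Set.mem_biUnion hB (by simpa using this 0))
    · exact hy₂ (Set.mem_biUnion hB (by simpa using this 1))
  · intro t _
    have := hsub (AffineMap.lineMap_mem t hx hy)
    simp only [Set.mem_union, Set.mem_iUnion, SetLike.mem_coe, exists_prop] at this
    simp only [Set.mem_iUnion, Finset.mem_union, Set.mem_ofPred_eq, exists_prop]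
    rcases this with ⟨B, hB, h⟩ | ⟨B, hB, h⟩
    exacts [⟨B, .inl hB, h⟩, ⟨B, .inr hB, h⟩]

theorem IsZIrreducible.exists_subset {T : Set (Fin d → K)} (hT : IsZIrreducible T)
    (F : Finset (AffineSubspace K (Fin d → K))) (h : T ⊆ ⋃ A ∈ F, (A : Set (Fin d → K))) :
    ∃ A ∈ F, T ⊆ A := by
  classical
  induction F using Finset.induction_on with
  | empty =>
    obtain ⟨x, hx⟩ := hT.1
    simpa using h hx
  | insert A F _ ih =>
    rw [Finset.set_biUnion_insert] at h
    rcases hT.2 _ _ ⟨{A}, by simp⟩ ⟨F, rfl⟩ h with h | h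
    · exact ⟨A, by simp, h⟩
    · obtain ⟨B, hB, h⟩ := ih h
      exact ⟨B, by simp [hB], h⟩

/-- `F` is the family of irreducible components of `J`: an antichain of nonempty affine subspaces
with union `J`. -/
structure IsDecomposition (F : Finset (AffineSubspace K (Fin d → K))) (J : Set (Fin d → K)) :
    Prop where
  nonempty : ∀ A ∈ F, (A : Set (Fin d → K)).Nonempty
  antichain : ∀ A ∈ F, ∀ B ∈ F, A ≤ B → A = B
  eq_biUnion : J = ⋃ A ∈ F, (A : Set (Fin d → K))

namespace IsDecomposition

variable {F F' : Finset (AffineSubspace K (Fin d → K))} {J J' : Set (Fin d → K)}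

theorem subset (h : IsDecomposition F J) {A : AffineSubspace K (Fin d → K)} (hA : A ∈ F) :
    (A : Set (Fin d → K)) ⊆ J := by
  rw [h.eq_biUnion]
  exact Set.subset_biUnion_of_mem (u := fun A : AffineSubspace K (Fin d → K) =>
    (A : Set (Fin d → K))) hA

theorem isZAffine (h : IsDecomposition F J) : IsZAffine J := ⟨F, h.eq_biUnion⟩

theorem subset_iff [Infinite K] (h : IsDecomposition F J) {B : AffineSubspace K (Fin d → K)}
    (hB : (B : Set (Fin d → K)).Nonempty) : (B : Set (Fin d → K)) ⊆ J ↔ ∃ A ∈ F, B ≤ A := by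
  refine ⟨fun hJ => (B.isZIrreducible hB).exists_subset F (h.eq_biUnion ▸ hJ), ?_⟩
  rintro ⟨A, hA, hBA⟩
  exact Set.Subset.trans hBA (h.subset hA)

/-- Members of `F` are irreducible, and every irreducible subset of `J` lies in one of them; the
antichain condition makes each of them maximal. -/
theorem zComponents_eq [Infinite K] (h : IsDecomposition F J) :
    zComponents J = (fun A : AffineSubspace K (Fin d → K) => (A : Set (Fin d → K))) '' F := by
  ext T
  constructor
  · rintro ⟨⟨hTJ, hT⟩, hmax⟩
    obtain ⟨A, hA, hTA⟩ := hT.exists_subset F (h.eq_biUnion ▸ hTJ)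
    exact ⟨A, hA, (hmax ⟨h.subset hA, A.isZIrreducible (h.nonempty A hA)⟩ hTA).antisymm hTA⟩
  · rintro ⟨A, hA, rfl⟩
    refine ⟨⟨h.subset hA, A.isZIrreducible (h.nonempty A hA)⟩, ?_⟩
    rintro T ⟨hTJ, hT⟩ hAT
    obtain ⟨B, hB, hTB⟩ := hT.exists_subset F (h.eq_biUnion ▸ hTJ)
    have := h.antichain A hA B hB (Set.Subset.trans hAT hTB)
    subst this
    exact hTB

theorem zLength_eq [Infinite K] (h : IsDecomposition F J) : zLength J = F.card := by
  rw [zLength, h.zComponents_eq, Set.InjOn.encard_image (SetLike.coe_injective.injOn),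
    Set.encard_coe_eq_coe_finsetCard]

open Classical in
/-- Adding a subspace `B` replaces the components that lie in `B` by `B`. -/
theorem insert_filter (h : IsDecomposition F J) {B : AffineSubspace K (Fin d → K)}
    (hB : (B : Set (Fin d → K)).Nonempty) (hBJ : ∀ A ∈ F, ¬ B ≤ A) :
    IsDecomposition (insert B (F.filter fun A => ¬ A ≤ B)) (J ∪ B) where
  nonempty A hA := by
    rcases Finset.mem_insert.1 hA with rfl | hA
    · exact hB
    · exact h.nonempty A (Finset.mem_filter.1 hA).1
  antichain A₁ h₁ A₂ h₂ hle := by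
    rw [Finset.mem_insert, Finset.mem_filter] at h₁ h₂
    rcases h₁ with rfl | h₁ <;> rcases h₂ with rfl | h₂
    · rfl
    · exact absurd hle (hBJ _ h₂.1)
    · exact absurd hle h₁.2
    · exact h.antichain _ h₁.1 _ h₂.1 hle
  eq_biUnion := by
    rw [Finset.set_biUnion_insert, h.eq_biUnion]
    ext x
    simp only [Set.mem_union, Set.mem_iUnion, Finset.mem_filter, SetLike.mem_coe, exists_prop]
    constructor
    · rintro (⟨A, hA, hx⟩ | hx)
      · by_cases hAB : A ≤ B
        · exact .inl (hAB hx)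
        · exact .inr ⟨A, ⟨hA, hAB⟩, hx⟩
      · exact .inl hx
    · rintro (hx | ⟨A, hA, hx⟩)
      · exact .inr hx
      · exact .inl ⟨A, hA.1, hx⟩

theorem singleton (u : Fin d → K) : IsDecomposition {affineSpan K {u}} {u} where
  nonempty := by simp
  antichain := by simp
  eq_biUnion := by simp

end IsDecomposition

theorem IsZAffine.exists_isDecomposition {J : Set (Fin d → K)} (hJ : IsZAffine J) :
    ∃ F, IsDecomposition F J := by
  classical
  obtain ⟨G, rfl⟩ := hJ
  let G' := G.filter fun A : AffineSubspace K (Fin d → K) => (A : Set (Fin d → K)).Nonempty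
  have hG' : ∀ A ∈ G', A ∈ G ∧ (A : Set (Fin d → K)).Nonempty := fun A hA => by
    simpa [G'] using hA
  -- After removal of empty members, the maximal ones form an antichain, and by finiteness every
  -- member lies below one of them.
  refine ⟨G'.filter fun A => Maximal (· ∈ G') A, ?_, ?_, ?_⟩
  · exact fun A hA => (hG' A (Finset.mem_filter.1 hA).1).2
  · exact fun A hA B hB hAB => hAB.antisymm ((Finset.mem_filter.1 hA).2.2 (Finset.mem_filter.1 hB).1 hAB)
  · ext x
    simp only [Set.mem_iUnion, Finset.mem_filter, SetLike.mem_coe, exists_prop]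
    constructor
    · rintro ⟨A, hA, hx⟩
      have hA' : A ∈ G' := Finset.mem_filter.2 ⟨hA, ⟨x, hx⟩⟩
      obtain ⟨B, hAB, hB⟩ := G'.exists_le_maximal hA'
      exact ⟨B, ⟨hB.1, hB⟩, hAB hx⟩
    · rintro ⟨A, hA, hx⟩
      exact ⟨A, (hG' A hA.1).1, hx⟩

/-! ### A bound for the length of strictly increasing chains -/

theorem finrank_direction_le (A : AffineSubspace K (Fin d → K)) :
    Module.finrank K A.direction ≤ d := by
  simpa using A.direction.finrank_le

/-- A weight of Z-affine sets that increases along chains of sets with at most `N` components. -/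
noncomputable def chainWeight (N : ℕ) (F : Finset (AffineSubspace K (Fin d → K))) : ℕ :=
  ∑ A ∈ F, (N + 1) ^ Module.finrank K A.direction

theorem chainWeight_le {N : ℕ} {F : Finset (AffineSubspace K (Fin d → K))} (hF : F.card ≤ N) :
    chainWeight N F ≤ N * (N + 1) ^ d := by
  refine (Finset.sum_le_card_nsmul F _ ((N + 1) ^ d) fun A _ =>
    Nat.pow_le_pow_right N.succ_pos (finrank_direction_le A)).trans ?_
  rw [smul_eq_mul]
  exact Nat.mul_le_mul_right _ hF

/-- Let `B` be a new component of largest dimension. Each lost component `A` lies in some component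
`A'` of `J'`, which is new by the antichain condition, so `dim A < dim A' ≤ dim B`. At most `N`
components are lost, and in base `N + 1` their total weight is less than the weight of `B` alone. -/
theorem IsDecomposition.chainWeight_lt [Infinite K] {N : ℕ}
    {F F' : Finset (AffineSubspace K (Fin d → K))} {J J' : Set (Fin d → K)}
    (h : IsDecomposition F J) (h' : IsDecomposition F' J') (hF : F.card ≤ N) (hJ : J ⊂ J') :
    chainWeight N F < chainWeight N F' := by
  classical
  have hD : (F' \ F).Nonempty := by
    rw [Finset.nonempty_iff_ne_empty, Ne, Finset.sdiff_eq_empty_iff_subset]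
    intro hsub
    refine hJ.2 ?_
    rw [h.eq_biUnion, h'.eq_biUnion]
    exact Set.biUnion_subset_biUnion_left hsub
  obtain ⟨B, hB, hmax⟩ := (F' \ F).exists_max_image (fun A => Module.finrank K A.direction) hD
  have key : ∀ A ∈ F \ F', Module.finrank K A.direction + 1 ≤ Module.finrank K B.direction := by
    intro A hA
    rw [Finset.mem_sdiff] at hA
    obtain ⟨A', hA', hle⟩ := (h'.subset_iff (h.nonempty A hA.1)).1
      ((h.subset hA.1).trans hJ.1)
    have hne : A ≠ A' := fun h => hA.2 (h ▸ hA')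
    have hD' : A' ∈ F' \ F := Finset.mem_sdiff.2 ⟨hA', fun hF => hne (h.antichain _ hA.1 _ hF hle)⟩
    exact (Submodule.finrank_lt_finrank_of_lt (AffineSubspace.direction_lt_of_nonempty
      (lt_of_le_of_ne hle hne) (h.nonempty A hA.1))).trans_le (hmax A' hD')
  have h1 : (N + 1) * ∑ A ∈ F \ F', (N + 1) ^ Module.finrank K A.direction ≤
      N * (N + 1) ^ Module.finrank K B.direction := by
    rw [Finset.mul_sum]
    refine (Finset.sum_le_card_nsmul _ _ ((N + 1) ^ Module.finrank K B.direction) fun A hA => ?_).trans ?_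
    · rw [← pow_succ']
      exact Nat.pow_le_pow_right N.succ_pos (key A hA)
    · rw [smul_eq_mul]
      exact Nat.mul_le_mul_right _ ((Finset.card_le_card Finset.sdiff_subset).trans hF)
  have h2 : ∑ A ∈ F \ F', (N + 1) ^ Module.finrank K A.direction <
      (N + 1) ^ Module.finrank K B.direction := by
    have : 0 < (N + 1) ^ Module.finrank K B.direction := by positivity
    nlinarith
  have h3 : (N + 1) ^ Module.finrank K B.direction ≤
      ∑ A ∈ F' \ F, (N + 1) ^ Module.finrank K A.direction :=
    Finset.single_le_sum (f := fun A : AffineSubspace K (Fin d → K) =>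
      (N + 1) ^ Module.finrank K A.direction) (fun _ _ => Nat.zero_le _) hB
  have h4 := Finset.sum_inter_add_sum_sdiff F F' fun A => (N + 1) ^ Module.finrank K A.direction
  have h5 := Finset.sum_inter_add_sum_sdiff F' F fun A => (N + 1) ^ Module.finrank K A.direction
  rw [Finset.inter_comm] at h5
  simp only [chainWeight]
  omega

end Zariski

/-! ### Correctness of the algorithm -/

section Correctness

variable {K : Type*} [Field K] {σ : Type*} {d : ℕ}

theorem spanDim_le (F : Finset (Set (Fin d → K))) : spanDim F ≤ d := finrank_direction_le _

theorem MergePair.mem {c k : ℕ} {F : Finset (Set (Fin d → K))} {A B : Set (Fin d → K)}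
    (h : MergePair c k F A B) : A ∈ F ∧ B ∈ F ∧ A ≠ B := by
  induction h with
  | descend hP _ _ _ ih => exact ⟨hP ih.1, hP ih.2.1, ih.2.2⟩
  | pick _ hA hB hne => exact ⟨hA, hB, hne⟩

/-- The pair found by the search lies in a common component of every Z-affine set that contains
the family and has at most `c` components. -/
theorem MergePair.affineSpan_subset {c k : ℕ} {F : Finset (Set (Fin d → K))}
    {A B : Set (Fin d → K)} (h : MergePair c k F A B) (hF : ∀ A ∈ F, IsZIrreducible A)
    (hcard : F.card = c ^ k + 1) (hdim : spanDim F ≤ k)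
    {G : Finset (AffineSubspace K (Fin d → K))} (hG : G.card ≤ c)
    (hFG : ∀ A ∈ F, A ⊆ ⋃ C ∈ G, (C : Set (Fin d → K))) :
    (affineSpan K (A ∪ B) : Set (Fin d → K)) ⊆ ⋃ C ∈ G, (C : Set (Fin d → K)) := by
  classical
  induction h with
  | descend hP hcard' hdim' _ ih =>
    exact ih (fun A hA => hF A (hP hA)) hcard' hdim' fun A hA => hFG A (hP hA)
  | @pick k F A B hnone hA hB hne =>
    choose! f hf hsub using fun A hA => (hF A hA).exists_subset G (hFG A hA)
    -- Pigeonhole: `c * c ^ k + 1` members are distributed over at most `c` components, so one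
    -- component receives more than `c ^ k`.
    obtain ⟨C, hC, hlt⟩ := Finset.exists_lt_card_fiber_of_mul_lt_card_of_maps_to (n := c ^ k) hf (by
      rw [hcard, pow_succ']
      exact Nat.lt_succ_of_le (Nat.mul_le_mul_right _ hG))
    obtain ⟨P, hP, hPcard⟩ := Finset.exists_subset_card_eq (Nat.succ_le_of_lt hlt)
    have hPF : P ⊆ F := hP.trans (Finset.filter_subset _ _)
    have hle : affineSpan K (⋃ A ∈ P, A) ≤ affineSpan K (⋃ A ∈ F, A) :=
      affineSpan_mono K (Set.biUnion_subset_biUnion_left hPF)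
    obtain ⟨A₀, hA₀⟩ : P.Nonempty := Finset.card_pos.1 (by omega)
    obtain ⟨x, hx⟩ := (hF A₀ (hPF hA₀)).1
    -- By `hnone` the span of `P` has dimension at least `k + 1`, which is also an upper bound for
    -- that of the whole family; the two spans therefore coincide.
    have hdir := Submodule.eq_of_le_of_finrank_le (AffineSubspace.direction_le hle)
      (hdim.trans (Nat.lt_of_not_le (hnone P hPF hPcard)))
    have heq := AffineSubspace.eq_of_direction_eq_of_nonempty_of_le hdir
      ⟨x, mem_affineSpan K (Set.mem_biUnion hA₀ hx)⟩ hle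
    have hPC : affineSpan K (⋃ A ∈ P, A) ≤ C := affineSpan_le.2 (Set.iUnion₂_subset fun A hA => by
      have := hP hA
      rw [Finset.mem_filter] at this
      exact this.2 ▸ hsub A this.1)
    refine Set.Subset.trans ?_ (Set.subset_biUnion_of_mem (u := fun A : AffineSubspace K (Fin d → K) =>
      (A : Set (Fin d → K))) hC)
    refine Set.Subset.trans ?_ (heq ▸ hPC : affineSpan K (⋃ A ∈ F, A) ≤ C)
    exact affineSpan_mono K (Set.union_subset (Set.subset_biUnion_of_mem (u := fun A => A) hA)
      (Set.subset_biUnion_of_mem (u := fun A => A) hB))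

/-- The image of an affine subspace under a matrix acting from the right. -/
def AffineSubspace.vecMul (A : AffineSubspace K (Fin d → K)) (N : Matrix (Fin d) (Fin d) K) :
    AffineSubspace K (Fin d → K) :=
  A.map (Matrix.vecMulLinear N).toAffineMap

theorem AffineSubspace.coe_vecMul (A : AffineSubspace K (Fin d → K))
    (N : Matrix (Fin d) (Fin d) K) : (A.vecMul N : Set (Fin d → K)) = (fun w => w ᵥ* N) '' A :=
  rfl

open Classical in
/-- Adding the image of a component. -/
theorem IsDecomposition.insert_image [Infinite K] {F : Finset (AffineSubspace K (Fin d → K))}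
    {J : Set (Fin d → K)} (h : IsDecomposition F J) {A : AffineSubspace K (Fin d → K)} (hA : A ∈ F)
    {N : Matrix (Fin d) (Fin d) K} (hN : ¬ (fun w => w ᵥ* N) '' A ⊆ J) :
    IsDecomposition (insert (A.vecMul N) (F.filter fun B => ¬ B ≤ A.vecMul N))
      (J ∪ (fun w => w ᵥ* N) '' A) := by
  have hne : (A.vecMul N : Set (Fin d → K)).Nonempty := (h.nonempty A hA).image _
  refine h.insert_filter hne fun B hB hle => hN ?_
  exact (h.subset_iff hne).2 ⟨B, hB, hle⟩

open Classical in
/-- Merging two components. -/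
theorem IsDecomposition.merge [Infinite K] {F : Finset (AffineSubspace K (Fin d → K))}
    {J : Set (Fin d → K)} (h : IsDecomposition F J) {A B : AffineSubspace K (Fin d → K)}
    (hA : A ∈ F) (hB : B ∈ F) (hne : A ≠ B) {C : AffineSubspace K (Fin d → K)}
    (hC : C = affineSpan K ((A : Set (Fin d → K)) ∪ B)) :
    IsDecomposition (insert C (F.filter fun A => ¬ A ≤ C)) (J ∪ C) ∧
      (insert C (F.filter fun A => ¬ A ≤ C)).card + 1 ≤ F.card := by
  have hAC : A ≤ C := fun x hx => hC ▸ mem_affineSpan K (.inl hx)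
  have hBC : B ≤ C := fun x hx => hC ▸ mem_affineSpan K (.inr hx)
  refine ⟨h.insert_filter ((h.nonempty A hA).mono hAC) fun D hD hle => hne ?_, ?_⟩
  · rw [h.antichain A hA D hD (hAC.trans hle), h.antichain B hB D hD (hBC.trans hle)]
  · have h1 : F.filter (fun A => ¬ A ≤ C) ⊆ (F.erase A).erase B := fun D hD => by
      rw [Finset.mem_filter] at hD
      refine Finset.mem_erase.2 ⟨?_, Finset.mem_erase.2 ⟨?_, hD.1⟩⟩
      · rintro rfl
        exact hD.2 hBC
      · rintro rfl
        exact hD.2 hAC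
    have h2 := Finset.card_le_card h1
    rw [Finset.card_erase_of_mem (Finset.mem_erase.2 ⟨hne.symm, hB⟩),
      Finset.card_erase_of_mem hA] at h2
    have h3 : 1 < F.card := Finset.one_lt_card.2 ⟨A, hA, B, hB, hne⟩
    have h4 := Finset.card_insert_le C (F.filter fun A => ¬ A ≤ C)
    omega

/-- The three facts preserved or produced by an iteration: the bound on the number of components,
strict growth (for termination), and containment in every invariant of length at most `c` (for
correctness). -/
theorem AlgoStep.exists_isDecomposition [Infinite K] {R : WeightedAutomaton K σ d} {c : ℕ}
    {J J' : Set (Fin d → K)} (hs : AlgoStep R c J J')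
    {F : Finset (AffineSubspace K (Fin d → K))} (h : IsDecomposition F J) (hF : F.card ≤ c ^ d) :
    (∃ F', IsDecomposition F' J' ∧ F'.card ≤ c ^ d) ∧ J ⊂ J' ∧
      ∀ I, IsZAffine I → R.IsInvariant I → zLength I ≤ c → J ⊆ I → J' ⊆ I := by
  classical
  obtain ⟨-, A, hA, a, hAJ, hs⟩ := hs
  rw [h.zComponents_eq] at hA
  obtain ⟨A, hA, rfl⟩ := hA
  have h1 := h.insert_image hA hAJ
  set F₁ := insert (A.vecMul (R.transition a)) (F.filter fun B => ¬ B ≤ A.vecMul (R.transition a))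
  set J₁ := J ∪ (fun w => w ᵥ* R.transition a) '' A
  have hcard : F₁.card ≤ F.card + 1 :=
    (Finset.card_insert_le _ _).trans (Nat.succ_le_succ (Finset.card_filter_le _ _))
  have hss : J ⊂ J₁ := ⟨Set.subset_union_left, fun hsub => hAJ (Set.subset_union_right.trans hsub)⟩
  have hI : ∀ I, IsZAffine I → R.IsInvariant I → zLength I ≤ c → J ⊆ I → J₁ ⊆ I := by
    refine fun I _ hI _ hJI => Set.union_subset hJI ?_
    rintro _ ⟨w, hw, rfl⟩
    exact hI.2 w (hJI (h.subset hA hw)) a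
  rw [h1.zLength_eq] at hs
  rcases hs with ⟨hle, rfl⟩ | ⟨hlt, hred⟩
  · exact ⟨⟨F₁, h1, by exact_mod_cast hle⟩, hss, hI⟩
  · obtain ⟨G, A', B', hG, hmp, rfl⟩ := hred
    have hlt' : c ^ d < F₁.card := by exact_mod_cast hlt
    obtain ⟨hA', hB', hne⟩ := hmp.mem
    have hGF : G = F₁.image fun A : AffineSubspace K (Fin d → K) => (A : Set (Fin d → K)) := by
      rw [← Finset.coe_inj, hG, h1.zComponents_eq, Finset.coe_image]
    have hirr : ∀ A ∈ G, IsZIrreducible A ∧ A ⊆ J₁ := fun A hA => by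
      rw [hGF, Finset.mem_image] at hA
      obtain ⟨A, hA, rfl⟩ := hA
      exact ⟨A.isZIrreducible (h1.nonempty A hA), h1.subset hA⟩
    -- An insertion adds at most one component, so REDUCE is called with exactly `c ^ d + 1` of
    -- them, as the pigeonhole argument at level `d` requires.
    have hGcard : G.card = c ^ d + 1 := by
      rw [hGF, Finset.card_image_of_injective _ SetLike.coe_injective]
      omega
    refine ⟨?_, hss.trans_subset Set.subset_union_left, ?_⟩
    · rw [hGF, Finset.mem_image] at hA' hB'
      obtain ⟨A', hA', rfl⟩ := hA'
      obtain ⟨B', hB', rfl⟩ := hB'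
      obtain ⟨h2, h3⟩ := h1.merge hA' hB' (fun h => hne (by rw [h])) rfl
      exact ⟨_, h2, by omega⟩
    · intro I hIZ hinv hlen hJI
      have hJ₁ := hI I hIZ hinv hlen hJI
      refine Set.union_subset hJ₁ ?_
      obtain ⟨H, hH⟩ := hIZ.exists_isDecomposition
      rw [hH.zLength_eq] at hlen
      rw [hH.eq_biUnion] at hJ₁ ⊢
      exact hmp.affineSpan_subset (fun A hA => (hirr A hA).1) hGcard (spanDim_le G)
        (by exact_mod_cast hlen) fun A hA => (hirr A hA).2.trans hJ₁

theorem AlgoReachable.invariants [Infinite K] {R : WeightedAutomaton K σ d} {c : ℕ} (hc : 1 ≤ c)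
    {J : Set (Fin d → K)} (h : AlgoReachable R c J) :
    (∃ F, IsDecomposition F J ∧ F.card ≤ c ^ d) ∧ R.u ∈ J ∧ J ⊆ invariantMeet R c := by
  induction h with
  | refl =>
    refine ⟨⟨_, .singleton R.u, by simpa using Nat.one_le_pow _ _ hc⟩, rfl, ?_⟩
    rintro _ rfl I hI
    exact hI.2.1.1
  | tail _ hs ih =>
    obtain ⟨⟨F, hF, hcard⟩, hu, hI⟩ := ih
    obtain ⟨h1, h2, h3⟩ := hs.exists_isDecomposition hF hcard
    exact ⟨h1, h2.1 hu, Set.subset_sInter fun I hI' =>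
      h3 I hI'.1 hI'.2.1 hI'.2.2 (hI.trans (Set.sInter_subset_of_mem hI'))⟩

/-- The number of iterations is bounded, for all choices. -/
theorem iterations_le [Infinite K] {R : WeightedAutomaton K σ d} {c : ℕ} (hc : 1 ≤ c) {n : ℕ}
    {J : ℕ → Set (Fin d → K)} (h0 : J 0 = {R.u}) (hJ : ∀ i < n, AlgoStep R c (J i) (J (i + 1))) :
    n ≤ c ^ d * (c ^ d + 1) ^ d := by
  -- Each step raises the weight by at least one, so after `i` steps it is at least `i`.
  have key : ∀ i ≤ n, ∃ F, IsDecomposition F (J i) ∧ F.card ≤ c ^ d ∧ i ≤ chainWeight (c ^ d) F := by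
    intro i
    induction i with
    | zero =>
      intro _
      exact ⟨_, h0 ▸ IsDecomposition.singleton R.u, by simpa using Nat.one_le_pow _ _ hc, Nat.zero_le _⟩
    | succ i ih =>
      intro hi
      obtain ⟨F, hF, hcard, hle⟩ := ih (by omega)
      obtain ⟨⟨F', hF', hcard'⟩, hss, -⟩ := (hJ i (by omega)).exists_isDecomposition hF hcard
      exact ⟨F', hF', hcard', (hle.trans_lt (hF.chainWeight_lt hF' hcard hss))⟩
  obtain ⟨F, -, hcard, hle⟩ := key n le_rfl
  exact hle.trans (chainWeight_le hcard)

end Correctness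

/-! ### Lists of points -/

section ListSpan

variable {K : Type*} [Field K] {d : ℕ}

/-- The affine span of a list of points. -/
abbrev listSpan (X : List (Fin d → K)) : AffineSubspace K (Fin d → K) := affineSpan K {x | x ∈ X}

theorem listSpan_le_iff {X : List (Fin d → K)} {A : AffineSubspace K (Fin d → K)} :
    listSpan X ≤ A ↔ ∀ x ∈ X, x ∈ A := affineSpan_le

theorem mem_listSpan {X : List (Fin d → K)} {x : Fin d → K} (h : x ∈ X) : x ∈ listSpan X :=
  mem_affineSpan K h

theorem listSpan_nonempty_iff {X : List (Fin d → K)} :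
    (listSpan X : Set (Fin d → K)).Nonempty ↔ X ≠ [] := by
  rw [affineSpan_nonempty]
  exact ⟨fun ⟨x, hx⟩ => List.ne_nil_of_mem hx, List.exists_mem_of_ne_nil X⟩

theorem AffineIndependent.length_le {X : List (Fin d → K)} (h : AffineIndependent K X.get) :
    X.length ≤ d + 1 := by
  have h1 := h.card_le_finrank_succ
  have h2 := (vectorSpan K (Set.range X.get)).finrank_le
  simp at h1 h2
  omega

theorem affineIndependent_get_nil : AffineIndependent K ([] : List (Fin d → K)).get :=
  have : Subsingleton (Fin ([] : List (Fin d → K)).length) := inferInstanceAs (Subsingleton (Fin 0))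
  affineIndependent_of_subsingleton K _

theorem listSpan_cons (x : Fin d → K) (X : List (Fin d → K)) :
    listSpan (x :: X) = affineSpan K (insert x (listSpan X : Set (Fin d → K))) := by
  rw [affineSpan_insert_affineSpan]
  refine congrArg _ (Set.ext fun y => ?_)
  simp

theorem AffineIndependent.get_cons {X : List (Fin d → K)} (h : AffineIndependent K X.get)
    {x : Fin d → K} (hx : x ∉ listSpan X) : AffineIndependent K (x :: X).get := by
  refine AffineIndependent.affineIndependent_of_notMem_span (i := (0 : Fin (X.length + 1))) ?_ ?_
  · have := h.comp_embedding (⟨fun y : { y : Fin (X.length + 1) // y ≠ 0 } => y.1.pred y.2,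
      fun a b hab => Subtype.ext (Fin.pred_inj.1 hab)⟩ : { y : Fin (X.length + 1) // y ≠ 0 } ↪ _)
    refine cast (congrArg _ (funext ?_)) this
    rintro ⟨y, hy⟩
    obtain ⟨z, rfl⟩ := Fin.exists_succ_eq.2 hy
    rfl
  · refine fun hmem => hx (affineSpan_mono K ?_ hmem)
    rintro _ ⟨y, hy, rfl⟩
    obtain ⟨z, rfl⟩ := Fin.exists_succ_eq.2 hy
    simp

theorem listSpan_map_vecMul (X : List (Fin d → K)) (N : Matrix (Fin d) (Fin d) K) :
    listSpan (X.map fun x => x ᵥ* N) = (listSpan X).vecMul N := by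
  rw [AffineSubspace.vecMul, listSpan, listSpan, AffineSubspace.map_span]
  congr 1
  ext x
  simp

theorem finrank_direction_listSpan_le {X : List (Fin d → K)} {k : ℕ} (h : X.length = k + 1) :
    Module.finrank K (listSpan X).direction ≤ k := by
  rw [direction_affineSpan]
  have := finrank_vectorSpan_range_le K X.get (n := k) (by simpa using h)
  rwa [Set.range_list_get] at this

/-- An affine subspace of dimension at most `k` that is spanned by `s` is spanned by `k + 1` points
of `s`. -/
theorem exists_listSpan_eq {s : Set (Fin d → K)} (hs : s.Nonempty) {k : ℕ}
    (hk : Module.finrank K (affineSpan K s).direction ≤ k) :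
    ∃ T : List (Fin d → K), T.length = k + 1 ∧ (∀ x ∈ T, x ∈ s) ∧ listSpan T = affineSpan K s := by
  obtain ⟨t, hts, hspan, hind⟩ := exists_affineIndependent K (Fin d → K) s
  have hfin : t.Finite := finite_set_of_fin_dim_affineIndependent K hind
  have : Fintype t := hfin.fintype
  have hne : t.Nonempty := by
    rw [← affineSpan_nonempty K, hspan, affineSpan_nonempty]
    exact hs
  obtain ⟨x₀, hx₀⟩ := hne
  have hcard := hind.card_le_finrank_succ
  rw [Subtype.range_coe, ← direction_affineSpan, hspan] at hcard
  rw [← Set.toFinset_card] at hcard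
  -- An affine basis contained in `s` is padded with copies of `x₀` to length exactly `k + 1`,
  -- because only tuples of one fixed length are enumerated.
  have hmem : ∀ x, x ∈ t.toFinset.toList ++ List.replicate (k + 1 - t.toFinset.card) x₀ ↔ x ∈ t := by
    intro x
    simp only [List.mem_append, Finset.mem_toList, Set.mem_toFinset, List.mem_replicate]
    refine ⟨?_, .inl⟩
    rintro (h | ⟨_, rfl⟩)
    exacts [h, hx₀]
  refine ⟨t.toFinset.toList ++ List.replicate (k + 1 - t.toFinset.card) x₀, ?_, ?_, ?_⟩
  · simp only [List.length_append, Finset.length_toList, List.length_replicate]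
    omega
  · exact fun x hx => hts ((hmem x).1 hx)
  · rw [← hspan, listSpan]
    congr 1
    ext x
    exact hmem x

theorem exists_list_of_affineSubspace (A : AffineSubspace K (Fin d → K)) :
    ∃ X : List (Fin d → K), AffineIndependent K X.get ∧ listSpan X = A := by
  obtain ⟨t, hts, hspan, hind⟩ := exists_affineIndependent K (Fin d → K) (A : Set (Fin d → K))
  have hfin : t.Finite := finite_set_of_fin_dim_affineIndependent K hind
  have hmem : ∀ x, x ∈ hfin.toFinset.toList ↔ x ∈ t := by simp
  refine ⟨hfin.toFinset.toList, ?_, ?_⟩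
  · exact hind.comp_embedding ⟨fun i => ⟨hfin.toFinset.toList.get i, (hmem _).1 (List.get_mem _ i)⟩,
      fun i j hij => (List.nodup_iff_injective_get.1 hfin.toFinset.nodup_toList)
        (congrArg Subtype.val hij)⟩
  · rw [AffineSubspace.affineSpan_coe] at hspan
    rw [← hspan, listSpan]
    congr 1
    ext x
    exact hmem x

/-- `L` lists the members of `F` without repetition, each by an affinely independent list of points
spanning it. -/
structure IsListing (L : List (List (Fin d → K))) (F : Finset (AffineSubspace K (Fin d → K))) :
    Prop where
  indep : ∀ X ∈ L, AffineIndependent K X.get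
  nodup : (L.map listSpan).Nodup
  mem_iff : ∀ A, A ∈ F ↔ ∃ X ∈ L, listSpan X = A

namespace IsListing

variable {L : List (List (Fin d → K))} {F : Finset (AffineSubspace K (Fin d → K))}

theorem card_eq (h : IsListing L F) : F.card = L.length := by
  classical
  have : F = (L.map listSpan).toFinset := by
    ext A
    rw [h.mem_iff]
    simp
  rw [this, List.toFinset_card_of_nodup h.nodup, List.length_map]

theorem mem (h : IsListing L F) {X : List (Fin d → K)} (hX : X ∈ L) : listSpan X ∈ F :=
  (h.mem_iff _).2 ⟨X, hX, rfl⟩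

theorem length_le (h : IsListing L F) {X : List (Fin d → K)} (hX : X ∈ L) : X.length ≤ d + 1 :=
  (h.indep X hX).length_le

open Classical in
-- The reversal is the order in which `Prog.filter` leaves the entries.
theorem insert_filter (h : IsListing L F) {Y : List (Fin d → K)} (hY : AffineIndependent K Y.get) :
    IsListing (Y :: (L.filter fun X => ¬ listSpan X ≤ listSpan Y).reverse)
      (insert (listSpan Y) (F.filter fun A => ¬ A ≤ listSpan Y)) where
  indep X hX := by
    rcases List.mem_cons.1 hX with rfl | hX
    · exact hY
    · exact h.indep X (List.mem_filter.1 (List.mem_reverse.1 hX)).1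
  nodup := by
    rw [List.map_cons, List.nodup_cons, List.map_reverse, List.nodup_reverse]
    refine ⟨?_, h.nodup.sublist (List.filter_sublist.map _)⟩
    intro hmem
    obtain ⟨X, hX, he⟩ := List.mem_map.1 (List.mem_reverse.1 hmem)
    have := (List.mem_filter.1 hX).2
    simp [he] at this
  mem_iff A := by
    simp only [Finset.mem_insert, Finset.mem_filter, h.mem_iff, List.mem_cons, List.mem_reverse,
      List.mem_filter, decide_eq_true_eq]
    constructor
    · rintro (rfl | ⟨⟨X, hX, rfl⟩, hle⟩)
      · exact ⟨Y, .inl rfl, rfl⟩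
      · exact ⟨X, .inr ⟨hX, hle⟩, rfl⟩
    · rintro ⟨X, rfl | ⟨hX, hle⟩, rfl⟩
      · exact .inl rfl
      · exact .inr ⟨⟨X, hX, rfl⟩, hle⟩

end IsListing

/-- A list of lists of points as a datum. -/
def Val.ofFam (L : List (List (Fin d → K))) : Val K := Val.ofList (L.map Val.ofPts)

/-- Passes from sets and `zComponents` to a finite family of subspaces, the form in which the
programs are analysed. -/
theorem represents_iff [Infinite K] {F : Finset (AffineSubspace K (Fin d → K))}
    {J : Set (Fin d → K)} (h : IsDecomposition F J) {z : Val K} :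
    Represents z J ↔ ∃ L, z = Val.ofFam L ∧ IsListing L F := by
  have hmap : ∀ L : List (List (Fin d → K)),
      (L.map fun X => (affineSpan K {x | x ∈ X} : Set (Fin d → K))) =
      (L.map listSpan).map (fun A : AffineSubspace K (Fin d → K) => (A : Set (Fin d → K))) := by
    intro L
    rw [List.map_map]
    rfl
  have hnd : ∀ L : List (List (Fin d → K)),
      (L.map fun X => (affineSpan K {x | x ∈ X} : Set (Fin d → K))).Nodup ↔
      (L.map listSpan).Nodup := fun L => by
    rw [hmap, List.nodup_map_iff SetLike.coe_injective]
  have hset : ∀ L : List (List (Fin d → K)),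
      {A | A ∈ L.map fun X => (affineSpan K {x | x ∈ X} : Set (Fin d → K))} = zComponents J ↔
      ∀ A, A ∈ F ↔ ∃ X ∈ L, listSpan X = A := fun L => by
    rw [h.zComponents_eq, hmap]
    constructor
    · intro he A
      have := Set.ext_iff.1 he (A : Set (Fin d → K))
      simpa using this.symm
    · intro he
      ext T
      simp only [Set.mem_image, Finset.mem_coe, he, List.mem_map]
      simp
  constructor
  · rintro ⟨L, rfl, h1, h2, h3⟩
    exact ⟨L, rfl, h1, (hnd L).1 h2, (hset L).1 h3⟩
  · rintro ⟨L, rfl, h1, h2, h3⟩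
    exact ⟨L, rfl, h1, (hnd L).2 h2, (hset L).2 h3⟩

/-- Used to show that no execution gets stuck: the body program can be run on a representation of
any reachable value. -/
theorem IsDecomposition.exists_represents [Infinite K]
    {F : Finset (AffineSubspace K (Fin d → K))} {J : Set (Fin d → K)} (h : IsDecomposition F J) :
    ∃ z, Represents z J := by
  choose f hf hspan using exists_list_of_affineSubspace (K := K) (d := d)
  refine ⟨_, (represents_iff h).2 ⟨F.toList.map f, rfl, ?_, ?_, ?_⟩⟩
  · simp only [List.mem_map]
    rintro _ ⟨A, _, rfl⟩
    exact hf A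
  · rw [List.map_map]
    have : listSpan ∘ f = id := funext hspan
    rw [this, List.map_id]
    exact F.nodup_toList
  · intro A
    simp [hspan]

end ListSpan

theorem Val.ofNat_eq {K : Type*} (n : ℕ) :
    (Val.ofNat n : Val K) = Val.ofList ((List.replicate n ()).map fun _ => .nil) := by
  simp [Val.ofNat]

/-! ### Programs for lists of points -/

namespace Prog

variable {K : Type*} [Field K] {S M : ℕ} {P Q T L A B C : Prog} {x y z a b w : Val K} {d : ℕ}

/-- Call `P` with one argument. -/
def call1 (A P : Prog) : Prog := comp (cons A nil) P

/-- Call `P` with two arguments. -/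
def call2 (A B P : Prog) : Prog := comp (cons A (cons B nil)) P

/-- Call `P` with three arguments. -/
def call3 (A B C P : Prog) : Prog := comp (cons A (cons B (cons C nil))) P

theorem Runs.call1 (hA : Runs S M A x a) (hP : Runs S M P (.cons a .nil) y) :
    Runs S M (call1 A P) x y :=
  (hA.cons .nil).comp hP

theorem Runs.call2 (hA : Runs S M A x a) (hB : Runs S M B x b)
    (hP : Runs S M P (.cons a (.cons b .nil)) y) : Runs S M (call2 A B P) x y :=
  (hA.cons (hB.cons .nil)).comp hP

theorem Runs.call3 (hA : Runs S M A x a) (hB : Runs S M B x b) (hC : Runs S M C x z)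
    (hP : Runs S M P (.cons a (.cons b (.cons z .nil))) y) : Runs S M (call3 A B C P) x y :=
  (hA.cons (hB.cons (hC.cons .nil))).comp hP

/-- Is the span of `X` contained in the span of `Y`, for the environment `X, Y`? -/
def spanLe : Prog := all (var 0) (call2 (var 0) (var 2) affMem)

theorem Runs.spanLe {X Y : List (Fin d → K)} (hd : d < S) (hX : X.length ≤ S) (hY : Y.length ≤ S) :
    Runs S M spanLe (.cons (.ofPts X) (.cons (.ofPts Y) x)) (.ofProp (listSpan X ≤ listSpan Y)) := by
  rw [propext listSpan_le_iff]
  exact Runs.all (e := Val.ofVec) .var_zero hX fun p _ => .call2 .var_zero .var_two (.affMem hY hd)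

/-- An affinely independent list with the same span as `X`, for the environment `X`. -/
def indep : Prog :=
  fold (var 0) nil (ite (call2 (var 0) (var 1) affMem) (cons (var 0) (var 1)) (var 1))

/-- Greedy choice: a point is kept only if it lies outside the span of those kept so far. The kept
list stays affinely independent, so it never exceeds `d + 1` points and each membership test stays
cheap. -/
theorem Runs.indep {X : List (Fin d → K)} (hd : d < S) (hX : X.length ≤ S) :
    ∃ X', Runs S M indep (.cons (.ofPts X) x) (.ofPts X') ∧ AffineIndependent K X'.get ∧
      listSpan X' = listSpan X := by
  obtain ⟨a, h, X', rfl, h1, h2⟩ := Runs.fold_inv (M := M) (L := var 0) (A := .nil)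
    (B := .ite (.call2 (var 0) (var 1) .affMem) (.cons (var 0) (var 1)) (var 1))
    (x := .cons (.ofPts X) x) (e := Val.ofVec) (l := X)
    (fun pre a => ∃ X' : List (Fin d → K), a = .ofPts X' ∧ AffineIndependent K X'.get ∧
      listSpan X' = listSpan pre) .var_zero hX .nil
    ⟨[], rfl, affineIndependent_get_nil, rfl⟩ (by
      rintro pre p _ post hl ⟨X', rfl, h1, h2⟩
      have ht := Runs.affMem (S := S) (M := M) (X := X') (p := p) (x := .nil)
        (h1.length_le.trans hd) hd
      have hspan : listSpan (pre ++ [p]) = listSpan (p :: pre) :=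
        congrArg (affineSpan K) (Set.ext fun y => by simp [or_comm])
      rw [hspan, listSpan_cons, ← h2]
      by_cases hp : p ∈ listSpan X'
      · refine ⟨_, Runs.ite_prop (.call2 .var_zero .var_one ht) (fun h => absurd hp h)
          (fun _ => .var_one), X', rfl, h1, ?_⟩
        rw [Set.insert_eq_of_mem hp, AffineSubspace.affineSpan_coe]
      · refine ⟨_, Runs.ite_prop (.call2 .var_zero .var_one ht) (fun _ => Runs.var_zero.cons .var_one)
          (fun h => absurd h hp), p :: X', rfl, h1.get_cons hp, listSpan_cons _ _⟩)
  exact ⟨X', h, h1, h2⟩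

/-- The images of the points `X` under the matrix `N`, for the environment `X, N`. -/
def image : Prog := map (var 0) (call2 (var 0) (var 2) vecMul)

theorem Runs.image {X : List (Fin d → K)} {N : Matrix (Fin d) (Fin d) K} (hd : d < S)
    (hX : X.length ≤ S) :
    Runs S M image (.cons (.ofPts X) (.cons (.ofMatrix N) x)) (.ofPts (X.map fun x => x ᵥ* N)) :=
  Runs.map (e := Val.ofVec) .var_zero hX fun _ _ => .call2 .var_zero .var_two (.vecMul hd.le)

/-- Add the component `Y` to the list `L` of components, for the environment `Y, L`. -/
def insertComp : Prog :=
  cons (var 0) (filter (var 1) (not (call2 (var 0) (var 1) spanLe)))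

open Classical in
theorem Runs.insertComp {Y : List (Fin d → K)} {L : List (List (Fin d → K))} (hd : d < S)
    (hY : Y.length ≤ S) (hL : L.length ≤ S) (hX : ∀ X ∈ L, X.length ≤ S) :
    Runs S M insertComp (.cons (.ofPts Y) (.cons (.ofFam L) x))
      (.ofFam (Y :: (L.filter fun X => ¬ listSpan X ≤ listSpan Y).reverse)) := by
  refine (Runs.var_zero.cons (Runs.filter (e := Val.ofPts) .var_one hL fun X h =>
    (Runs.call2 .var_zero .var_one (.spanLe hd (hX X h) hY)).not_prop)).of_eq ?_
  rw [Val.ofFam, List.map_cons, Val.ofList]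
  congr!

/-- All points of a list of lists of points. -/
def points : Prog := fold (var 0) nil (appendRev (var 0) (var 1))

theorem Runs.points {L : List (List (Fin d → K))} {m : ℕ} (hL : L.length ≤ S) (hm : m ≤ S)
    (hX : ∀ X ∈ L, X.length ≤ m) :
    ∃ X : List (Fin d → K), Runs S M points (.cons (.ofFam L) x) (.ofPts X) ∧
      (∀ p, p ∈ X ↔ ∃ Y ∈ L, p ∈ Y) ∧ X.length ≤ L.length * m := by
  obtain ⟨a, h, X, rfl, h1, h2⟩ := Runs.fold_inv (M := M) (L := var 0) (A := .nil)
    (B := .appendRev (var 0) (var 1)) (x := .cons (.ofFam L) x) (e := Val.ofPts) (l := L)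
    (fun pre a => ∃ X : List (Fin d → K), a = .ofPts X ∧ (∀ p, p ∈ X ↔ ∃ Y ∈ pre, p ∈ Y) ∧
      X.length ≤ pre.length * m) .var_zero hL .nil ⟨[], rfl, by simp⟩ (by
      rintro pre Y _ post hl ⟨X, rfl, h1, h2⟩
      have hY : Y.length ≤ m := hX Y (by simp [hl])
      refine ⟨_, Runs.appendRev (l := Y) (l' := X) (e := Val.ofVec) .var_zero .var_one (hY.trans hm),
        _, rfl, ?_, ?_⟩
      · intro p
        simp only [List.mem_append, List.mem_reverse, h1, List.mem_singleton]
        constructor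
        · rintro (h | ⟨Z, hZ, h⟩)
          exacts [⟨Y, .inr rfl, h⟩, ⟨Z, .inl hZ, h⟩]
        · rintro ⟨Z, hZ | rfl, h⟩
          exacts [.inr ⟨Z, hZ, h⟩, .inl h]
      · simp only [List.length_append, List.length_reverse, List.length_singleton, add_mul]
        omega)
  exact ⟨X, h, h1, h2⟩

/-- All tuples of points from `X`, of the length of the list `l`, for the environment `l, X`. -/
def tuples : Prog :=
  fold (var 0) (cons nil nil)
    (fold (var 3) nil (appendRev (map (var 3) (cons (var 1) (var 0))) (var 1)))

theorem Runs.tuples {α : Type*} {e : α → Val K} {l : List α} {X : List (Fin d → K)}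
    (hl : l.length ≤ S) (hX : X.length ≤ S) (hlX : ∀ j ≤ l.length, X.length ^ j ≤ S) :
    ∃ Z : List (List (Fin d → K)),
      Runs S M tuples (.cons (.ofList (l.map e)) (.cons (.ofPts X) x)) (.ofFam Z) ∧
      Z.length ≤ S ∧ ∀ T, T ∈ Z ↔ T.length = l.length ∧ ∀ p ∈ T, p ∈ X := by
  obtain ⟨a, h, Z, rfl, h1, h2⟩ := Runs.fold_inv (M := M) (L := var 0) (A := .cons .nil .nil)
    (B := .fold (var 3) .nil (.appendRev (.map (var 3) (.cons (var 1) (var 0))) (var 1)))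
    (x := .cons (.ofList (l.map e)) (.cons (.ofPts X) x)) (e := e) (l := l)
    (fun pre a => ∃ Z : List (List (Fin d → K)), a = .ofFam Z ∧
      Z.length = X.length ^ pre.length ∧ ∀ T, T ∈ Z ↔ T.length = pre.length ∧ ∀ p ∈ T, p ∈ X)
    .var_zero hl (Runs.nil.cons .nil)
    ⟨[[]], rfl, by simp, fun T => by cases T <;> simp⟩ (by
      rintro pre h _ post hpre ⟨Z, rfl, h1, h2⟩
      have hZ : Z.length ≤ S := by
        rw [h1]
        exact hlX _ (by simp [hpre])
      obtain ⟨a, h, Z', rfl, h3, h4⟩ := Runs.fold_inv (M := M) (L := var 3) (A := .nil)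
        (B := .appendRev (.map (var 3) (.cons (var 1) (var 0))) (var 1))
        (x := .cons (e h) (.cons (.ofFam Z) (.cons (.ofList (l.map e)) (.cons (.ofPts X) x))))
        (e := Val.ofVec) (l := X)
        (fun pre a => ∃ Z' : List (List (Fin d → K)), a = .ofFam Z' ∧
          Z'.length = pre.length * Z.length ∧ ∀ T, T ∈ Z' ↔ ∃ p ∈ pre, ∃ T' ∈ Z, T = p :: T')
        .var_three hX .nil ⟨[], rfl, by simp, by simp⟩ (by
          rintro pre p _ post hpre ⟨Z', rfl, h3, h4⟩
          refine ⟨_, Runs.appendRev (l := Z.map (p :: ·)) (l' := Z') (e := Val.ofPts)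
            (Runs.map (e := Val.ofPts) .var_three hZ fun T _ => ?_) .var_one (by simpa using hZ),
            _, rfl, ?_, ?_⟩
          · exact Runs.var_one.cons .var_zero
          · simp [h3]
            ring
          · intro T
            simp only [List.mem_append, List.mem_reverse, List.mem_map, h4, List.mem_singleton]
            constructor
            · rintro (⟨T', hT', rfl⟩ | ⟨q, hq, h⟩)
              exacts [⟨p, .inr rfl, T', hT', rfl⟩, ⟨q, .inl hq, h⟩]
            · rintro ⟨q, hq | rfl, T', hT', rfl⟩
              exacts [.inr ⟨q, hq, T', hT', rfl⟩, .inl ⟨T', hT', rfl⟩])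
      refine ⟨_, h, Z', rfl, ?_, ?_⟩
      · rw [h3, h1, List.length_append, List.length_singleton, pow_succ']
      · intro T
        simp only [h4, h2, List.length_append, List.length_singleton]
        constructor
        · rintro ⟨p, hp, T, ⟨hT, hTX⟩, rfl⟩
          simpa [hT, hp] using hTX
        · rintro ⟨hlen, hT⟩
          cases T with
          | nil => simp at hlen
          | cons p T => exact ⟨p, hT p (by simp), T, ⟨by simpa using hlen,
              fun q hq => hT q (by simp [hq])⟩, rfl⟩)
  exact ⟨Z, h, h1 ▸ hlX _ le_rfl, h2⟩

/-- The power of the natural number `c` with the length of the list `l` as exponent, for the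
environment `c, l`. -/
def pow : Prog :=
  fold (var 1) (cons nil nil) (fold (var 1) nil (fold (var 4) (var 1) (cons nil (var 1))))

/-- Unary arithmetic by three nested folds, over the exponent, over the power reached so far and
over `c`: powers by repeated multiplication, products by repeated addition. -/
theorem Runs.pow {α : Type*} {e : α → Val K} {l : List α} {c : ℕ} (hl : l.length ≤ S) (hc : c ≤ S)
    (hlc : ∀ j ≤ l.length, c ^ j ≤ S) :
    Runs S M pow (.cons (.ofNat c) (.cons (.ofList (l.map e)) x)) (.ofNat (c ^ l.length)) := by
  obtain ⟨a, h, rfl⟩ := Runs.fold_inv (M := M) (L := var 1) (A := .cons .nil .nil)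
    (B := .fold (var 1) .nil (.fold (var 4) (var 1) (.cons .nil (var 1))))
    (x := .cons (.ofNat c) (.cons (.ofList (l.map e)) x)) (e := e) (l := l)
    (fun pre a => a = .ofNat (c ^ pre.length)) .var_one hl (Runs.nil.cons .nil) rfl (by
      rintro pre h _ post hpre rfl
      obtain ⟨a, h, rfl⟩ := Runs.fold_inv (S := S) (M := M) (L := var 1) (A := .nil)
        (B := .fold (var 4) (var 1) (.cons .nil (var 1)))
        (x := .cons (e h) (.cons (.ofNat (c ^ pre.length))
          (.cons (.ofNat c) (.cons (.ofList (l.map e)) x))))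
        (e := fun _ => .nil) (l := List.replicate (c ^ pre.length) ())
        (fun pre a => a = .ofNat (pre.length * c)) (by rw [← Val.ofNat_eq]; exact .var_one)
        (by simpa using hlc _ (by simp [hpre])) .nil (by simp [Val.ofNat, Val.ofList]) (by
          rintro pre' h' _ post' - rfl
          obtain ⟨a, h, rfl⟩ := Runs.fold_inv (S := S) (M := M) (L := var 4) (A := var 1)
            (B := .cons .nil (var 1))
            (x := .cons .nil (.cons (.ofNat (pre'.length * c)) (.cons (e h)
              (.cons (.ofNat (c ^ pre.length)) (.cons (.ofNat c) (.cons (.ofList (l.map e)) x))))))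
            (e := fun _ => .nil) (l := List.replicate c ())
            (fun pre a => a = .ofNat (pre'.length * c + pre.length))
            (by rw [← Val.ofNat_eq]; exact .var_four) (by simpa using hc) .var_one (by simp) (by
              rintro pre h _ post - rfl
              exact ⟨_, Runs.nil.cons .var_one, by
                rw [List.length_append, List.length_singleton, ← add_assoc]
                simp [Val.ofNat, List.replicate_succ, Val.ofList]⟩)
          exact ⟨_, h, by simp [add_mul]⟩)
      exact ⟨_, h, by simp [pow_succ]⟩)
  exact h

end Prog

/-! ### The search for a pair of components -/

section Search

variable {K : Type*} [Field K] {d : ℕ}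

open Classical in
/-- The affine spans of the members of a list, as a family of sets. -/
noncomputable def spanSets (L : List (List (Fin d → K))) : Finset (Set (Fin d → K)) :=
  (L.map fun X => (listSpan X : Set (Fin d → K))).toFinset

theorem mem_spanSets {L : List (List (Fin d → K))} {A : Set (Fin d → K)} :
    A ∈ spanSets L ↔ ∃ X ∈ L, (listSpan X : Set (Fin d → K)) = A := by
  simp [spanSets]

theorem spanSets_mono {L L' : List (List (Fin d → K))} (h : L ⊆ L') : spanSets L ⊆ spanSets L' := by
  intro A hA
  obtain ⟨X, hX, rfl⟩ := mem_spanSets.1 hA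
  exact mem_spanSets.2 ⟨X, h hX, rfl⟩

theorem card_spanSets {L : List (List (Fin d → K))} (h : (L.map listSpan).Nodup) :
    (spanSets L).card = L.length := by
  rw [spanSets, List.toFinset_card_of_nodup, List.length_map]
  have := h.map (f := fun A : AffineSubspace K (Fin d → K) => (A : Set (Fin d → K)))
    SetLike.coe_injective
  rwa [List.map_map] at this

theorem spanDim_spanSets_le {L : List (List (Fin d → K))} {T : List (Fin d → K)} {k : ℕ}
    (hT : T.length = k + 1) (h : ∀ X ∈ L, listSpan X ≤ listSpan T) : spanDim (spanSets L) ≤ k := by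
  refine (Submodule.finrank_mono (AffineSubspace.direction_le ?_)).trans
    (finrank_direction_listSpan_le hT)
  refine affineSpan_le.2 (Set.iUnion₂_subset fun A hA => ?_)
  obtain ⟨X, hX, rfl⟩ := mem_spanSets.1 hA
  exact h X hX

open Classical in
/-- If few members of `L` lie in the span of `k + 1` points of `L`, then no large subfamily spans a
space of dimension at most `k`. -/
theorem lt_spanDim_of_tuples {L : List (List (Fin d → K))} (hne : ∀ X ∈ L, X ≠ []) {k n : ℕ}
    (h : ∀ T : List (Fin d → K), T.length = k + 1 → (∀ p ∈ T, ∃ X ∈ L, p ∈ X) →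
      (L.filter fun X => listSpan X ≤ listSpan T).length ≤ n)
    {P : Finset (Set (Fin d → K))} (hP : P ⊆ spanSets L) (hcard : P.card = n + 1) :
    ¬ spanDim P ≤ k := by
  intro hdim
  let s : Set (Fin d → K) := {x | ∃ X ∈ L, (listSpan X : Set (Fin d → K)) ∈ P ∧ x ∈ X}
  have hle : affineSpan K s ≤ affineSpan K (⋃ A ∈ P, A) := by
    refine affineSpan_mono K ?_
    rintro x ⟨X, -, hXP, hx⟩
    exact Set.mem_biUnion hXP (mem_listSpan hx)
  have hs : ∀ X ∈ L, (listSpan X : Set (Fin d → K)) ∈ P → listSpan X ≤ affineSpan K s :=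
    fun X hX hXP => listSpan_le_iff.2 fun x hx => mem_affineSpan K ⟨X, hX, hXP, hx⟩
  obtain ⟨A, hA⟩ : P.Nonempty := Finset.card_pos.1 (by omega)
  obtain ⟨X, hX, rfl⟩ := mem_spanSets.1 (hP hA)
  obtain ⟨x, hx⟩ := List.exists_mem_of_ne_nil X (hne X hX)
  -- The points representing the members of `P` span a space of dimension at most `k`, so `k + 1` of
  -- them suffice. All `n + 1` members of `P` then lie in the span of `T`, against the bound `n`.
  obtain ⟨T, hT, hTs, hspan⟩ := exists_listSpan_eq (s := s) ⟨x, X, hX, hA, hx⟩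
    ((Submodule.finrank_mono (AffineSubspace.direction_le hle)).trans hdim)
  have h1 := h T hT fun p hp => by
    obtain ⟨X, hX, -, hp⟩ := hTs p hp
    exact ⟨X, hX, hp⟩
  have h2 : P ⊆ spanSets (L.filter fun X => listSpan X ≤ listSpan T) := by
    intro A hA
    obtain ⟨X, hX, rfl⟩ := mem_spanSets.1 (hP hA)
    exact mem_spanSets.2 ⟨X, by simpa [hX, hspan] using hs X hX hA, rfl⟩
  have h3 := Finset.card_le_card h2
  have h4 : (spanSets (L.filter fun X => listSpan X ≤ listSpan T)).card ≤
      (L.filter fun X => listSpan X ≤ listSpan T).length := by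
    refine (List.toFinset_card_le _).trans ?_
    rw [List.length_map]
  omega

/-- Two different members span a space of positive dimension. -/
theorem spanDim_pos {L : List (List (Fin d → K))} (hne : ∀ X ∈ L, X ≠ [])
    (hnd : (L.map listSpan).Nodup) (hL : 2 ≤ L.length) : 0 < spanDim (spanSets L) := by
  by_contra h0
  rw [← card_spanSets hnd] at hL
  obtain ⟨A, hA, B, hB, hAB⟩ := Finset.one_lt_card.1 (Nat.lt_of_succ_le hL)
  have hbot := Submodule.finrank_eq_zero.1 (Nat.eq_zero_of_not_pos h0)
  have hsub : ∀ x ∈ affineSpan K (⋃ A ∈ spanSets L, A), ∀ y ∈ affineSpan K (⋃ A ∈ spanSets L, A),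
      x = y := fun x hx y hy => by
    have := AffineSubspace.vsub_mem_direction hx hy
    rw [hbot, Submodule.mem_bot] at this
    exact vsub_eq_zero_iff_eq.1 this
  have hmem : ∀ A ∈ spanSets L, A.Nonempty ∧ A ⊆ affineSpan K (⋃ A ∈ spanSets L, A) := by
    intro A hA
    refine ⟨?_, (Set.subset_biUnion_of_mem (u := fun A => A) hA).trans (subset_affineSpan K _)⟩
    obtain ⟨X, hX, rfl⟩ := mem_spanSets.1 hA
    exact listSpan_nonempty_iff.2 (hne X hX)
  obtain ⟨⟨a, ha⟩, hA'⟩ := hmem A hA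
  obtain ⟨⟨b, hb⟩, hB'⟩ := hmem B hB
  refine hAB (Set.ext fun x => ⟨fun hx => ?_, fun hx => ?_⟩)
  · rwa [hsub x (hA' hx) b (hB' hb)]
  · rwa [hsub x (hB' hx) a (hA' ha)]

end Search

/-- `S` bounds the lengths of all lists that occur in a run of the algorithm. -/
structure SizeBound (S c d : ℕ) : Prop where
  -- Not implied by the other bound when `d = 0`.
  le : c ≤ S
  -- At most `c ^ d + 1` components with at most `d + 1` points each give the base; the exponent
  -- covers all tuple lengths and also the number of iterations. The factor `d + 2` makes `d + 1 <
  -- S` strict.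
  pow_le : ((c ^ d + 1) * (d + 2)) ^ (d + 1) ≤ S

namespace SizeBound

variable {S c d : ℕ}

theorem base_pow_le (h : SizeBound S c d) {j : ℕ} (hj : j ≤ d + 1) :
    ((c ^ d + 1) * (d + 2)) ^ j ≤ S :=
  (Nat.pow_le_pow_right (by positivity) hj).trans h.pow_le

theorem base_le (h : SizeBound S c d) : (c ^ d + 1) * (d + 2) ≤ S := by
  simpa using h.base_pow_le (j := 1) (by omega)

theorem dim_lt (h : SizeBound S c d) : d + 1 < S := by
  have := h.base_le
  nlinarith [Nat.zero_le (c ^ d)]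

theorem count_le (h : SizeBound S c d) : c ^ d + 1 ≤ S := by
  have := h.base_le
  nlinarith [Nat.zero_le (c ^ d)]

theorem exp_le (h : SizeBound S c d) (hc : 1 ≤ c) {j : ℕ} (hj : j ≤ d) : c ^ j ≤ S :=
  (Nat.pow_le_pow_right hc hj).trans ((Nat.le_succ _).trans h.count_le)

end SizeBound

/-! ### Programs for the search in REDUCE -/

namespace Prog

variable {K : Type*} [Field K] {S M : ℕ} {P Q T L A B C : Prog} {x y z a b w : Val K} {d : ℕ}

/-- The first `n + 1` members of the list `L` of lists that lie in the span of `T`, if there are so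
many, for the environment `T, L, n`. -/
def packIn : Prog :=
  letIn (filter (var 1) (call2 (var 0) (var 1) spanLe))
    (ite (drop (var 0) (var 3)) nil (drop (var 0) (drop (var 0) (cons nil (var 3)))))

open Classical in
theorem Runs.packIn {T : List (Fin d → K)} {L : List (List (Fin d → K))} {n : ℕ} (hd : d + 1 < S)
    (hT : T.length ≤ S) (hL : L.length ≤ S) (hX : ∀ X ∈ L, X.length ≤ S) (hn : n < S) :
    ∃ a, Runs S M packIn (.cons (.ofPts T) (.cons (.ofFam L) (.cons (.ofNat n) x))) a ∧
      ((a = .nil ∧ (L.filter fun X => listSpan X ≤ listSpan T).length ≤ n) ∨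
        ∃ P, a = .ofFam P ∧ P.length = n + 1 ∧ P.Sublist L.reverse ∧
          ∀ X ∈ P, listSpan X ≤ listSpan T) := by
  have hf : Runs S M (.filter (var 1) (.call2 (var 0) (var 1) .spanLe))
      (.cons (.ofPts T) (.cons (.ofFam L) (.cons (.ofNat n) x)))
      (.ofFam (L.filter fun X => listSpan X ≤ listSpan T).reverse) := by
    refine (Runs.filter (e := Val.ofPts) .var_one hL fun X h =>
      Runs.call2 .var_zero .var_one (.spanLe (by omega) (hX X h) hT)).of_eq ?_
    rw [Val.ofFam]
  have hlen : (L.filter fun X => listSpan X ≤ listSpan T).length ≤ S :=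
    (List.length_filter_le _ _).trans hL
  have hsub : (L.filter fun X => listSpan X ≤ listSpan T).Sublist L := List.filter_sublist
  have hle : ∀ X ∈ L.filter fun X => listSpan X ≤ listSpan T, listSpan X ≤ listSpan T :=
    fun X hX => by simpa using (List.mem_filter.1 hX).2
  generalize (L.filter fun X => listSpan X ≤ listSpan T) = Q at *
  have hdrop := Runs.drop (S := S) (M := M) (L := var 0) (A := var 3)
    (x := .cons (.ofFam Q.reverse) (.cons (.ofPts T) (.cons (.ofFam L) (.cons (.ofNat n) x))))
    (e := Val.ofPts) (l := Q.reverse) (l' := List.replicate n ()) (e' := fun _ => .nil) .var_zero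
    (by rw [← Val.ofNat_eq]; exact .var_three) (by simpa using hn.le)
  by_cases hQ : Q.length ≤ n
  · refine ⟨.nil, hf.letIn (Runs.ite_nil (hdrop.of_eq ?_) .nil), .inl ⟨rfl, hQ⟩⟩
    rw [Val.ofList_eq_nil, List.map_eq_nil_iff, List.drop_eq_nil_iff]
    simpa using hQ
  · have hdrop' := Runs.drop (S := S) (M := M) (L := var 0) (A := .cons .nil (var 3))
      (x := .cons (.ofFam Q.reverse) (.cons (.ofPts T) (.cons (.ofFam L) (.cons (.ofNat n) x))))
      (e := Val.ofPts) (l := Q.reverse) (l' := List.replicate (n + 1) ()) (e' := fun _ => .nil)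
      .var_zero (by rw [← Val.ofNat_eq]; exact Runs.nil.cons .var_three) (by simpa using hn)
    -- The inner drop leaves `Q.length - (n + 1)` entries; dropping that many from `Q.reverse`
    -- leaves `n + 1`.
    have hdrop'' := Runs.drop (L := var 0) (l := Q.reverse) (e := Val.ofPts) .var_zero hdrop'
      (by simp; omega)
    refine ⟨_, hf.letIn (Runs.ite_ne hdrop ?_ hdrop''), .inr ⟨_, rfl, ?_, ?_, ?_⟩⟩
    · rw [Ne, Val.ofList_eq_nil, List.map_eq_nil_iff, List.drop_eq_nil_iff]
      simpa using hQ
    · simp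
      omega
    · exact (List.drop_sublist _ _).trans hsub.reverse
    · exact fun X hX => hle X (List.mem_reverse.1 (List.mem_of_mem_drop hX))

/-- A subfamily of `L` with `c ^ k + 1` members whose span has dimension at most `k`, if there is
one, where `k` is the length of `l`, for the environment `l, L, c`. -/
def findPack : Prog :=
  letIn (call2 (var 2) (var 0) pow)
    (fold (call2 (cons nil (var 1)) (call1 (var 2) points) tuples) nil
      (ite (var 1) (call3 (var 0) (var 4) (var 2) packIn) (var 1)))

/-- Tuples of points replace subfamilies, which keeps the enumeration below `S`. Nothing is lost:
failure for all tuples excludes every subfamily, and a pack found inside the span of `k + 1` points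
has a span of dimension at most `k`. -/
theorem Runs.findPack {α : Type*} {e : α → Val K} {l : List α} {L : List (List (Fin d → K))} {c : ℕ}
    (hS : SizeBound S c d) (hc : 1 ≤ c) (hl : l.length < d) (hL : L.length ≤ c ^ d + 1)
    (hX : ∀ X ∈ L, X.length ≤ d + 1) (hne : ∀ X ∈ L, X ≠ []) :
    ∃ a, Runs S M findPack (.cons (.ofList (l.map e)) (.cons (.ofFam L) (.cons (.ofNat c) x))) a ∧
      ((a = .nil ∧ ∀ P ⊆ spanSets L, P.card = c ^ l.length + 1 → ¬ spanDim P ≤ l.length) ∨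
        ∃ P, a = .ofFam P ∧ P.length = c ^ l.length + 1 ∧ P.Sublist L.reverse ∧
          spanDim (spanSets P) ≤ l.length) := by
  classical
  have hd := hS.dim_lt
  have hLS := hL.trans hS.count_le
  have hpow : c ^ l.length < S := by
    have := Nat.pow_le_pow_right hc hl.le
    have := hS.count_le
    omega
  obtain ⟨X, hXr, hXmem, hXlen⟩ := Runs.points (M := M) (x := .nil) hLS hd.le hX
  have hXlen' : X.length ≤ (c ^ d + 1) * (d + 2) := hXlen.trans (Nat.mul_le_mul hL (by omega))
  have hXS := hXlen'.trans hS.base_le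
  -- One more entry than `l`, since `k + 1` points are needed to span dimension `k`.
  let l' : List (Val K) := .nil :: l.map e
  obtain ⟨Z, hZr, hZlen, hZ⟩ := Runs.tuples (M := M) (x := .nil) (e := id) (l := l') (X := X)
    (S := S) (by simp [l']; omega) hXS fun j hj => by
      simp only [l', List.length_cons, List.length_map] at hj
      exact (Nat.pow_le_pow_left hXlen' j).trans (hS.base_pow_le (by omega))
  simp only [l', List.length_cons, List.length_map] at hZ
  obtain ⟨a, h, hI⟩ := Runs.fold_inv (S := S) (M := M)
    (L := .call2 (.cons .nil (var 1)) (.call1 (var 2) .points) .tuples) (A := .nil)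
    (B := .ite (var 1) (.call3 (var 0) (var 4) (var 2) .packIn) (var 1))
    (x := .cons (.ofNat (c ^ l.length)) (.cons (.ofList (l.map e)) (.cons (.ofFam L) (.cons (.ofNat c) x))))
    (e := Val.ofPts) (l := Z) (fun pre a =>
      (a = .nil ∧ ∀ T ∈ pre, (L.filter fun X => listSpan X ≤ listSpan T).length ≤ c ^ l.length) ∨
      ∃ P, a = .ofFam P ∧ P.length = c ^ l.length + 1 ∧ P.Sublist L.reverse ∧
        ∃ T ∈ Z, ∀ X ∈ P, listSpan X ≤ listSpan T)
    (.call2 (Runs.nil.cons .var_one) (.call1 .var_two hXr) (by simpa [l', Val.ofList, Val.ofFam] using hZr))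
    hZlen .nil (by simp) (by
      rintro pre T a post hpre (⟨rfl, hI⟩ | ⟨P, rfl, hP⟩)
      · have hT : T ∈ Z := by simp [hpre]
        obtain ⟨a, h, ha⟩ := Runs.packIn (M := M) (x := .nil) (T := T) hd
          (by rw [((hZ T).1 hT).1]; omega) hLS (fun X h => (hX X h).trans hd.le) hpow
        refine ⟨a, Runs.ite_nil .var_one (.call3 .var_zero .var_four .var_two h), ?_⟩
        rcases ha with ⟨rfl, ha⟩ | ⟨P, rfl, h1, h2, h3⟩
        · refine .inl ⟨rfl, fun T' hT' => ?_⟩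
          rcases List.mem_append.1 hT' with hT' | hT'
          · exact hI T' hT'
          · rwa [List.mem_singleton.1 hT']
        · exact .inr ⟨P, rfl, h1, h2, T, hT, h3⟩
      · refine ⟨_, Runs.ite_ne .var_one ?_ .var_one, .inr ⟨P, rfl, hP⟩⟩
        rw [Val.ofFam, Ne, Val.ofList_eq_nil, List.map_eq_nil_iff]
        rintro rfl
        simp at hP)
  refine ⟨a, Runs.letIn (Runs.call2 .var_two .var_zero (Runs.pow (by omega) hS.le fun j hj =>
    hS.exp_le hc (by omega))) h, ?_⟩
  rcases hI with ⟨rfl, hI⟩ | ⟨P, rfl, h1, h2, T, hT, h3⟩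
  · refine .inl ⟨rfl, fun P hP hcard => lt_spanDim_of_tuples hne (fun T hT hTX => hI T ?_) hP hcard⟩
    exact (hZ T).2 ⟨hT, fun p hp => (hXmem p).2 (hTX p hp)⟩
  · exact .inr ⟨P, rfl, h1, h2, spanDim_spanSets_le ((hZ T).1 hT).1 h3⟩

/-- One level of the search, for the environment `l, L, c`. -/
def searchStep : Prog :=
  letIn (call3 (comp (var 0) tail) (var 1) (var 2) findPack)
    (ite (var 0) (cons nil (cons (var 2) (cons (var 3) nil)))
      (cons (comp (var 1) tail) (cons (var 0) (cons (var 3) nil))))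

theorem LoopRuns.mono {n n' : ℕ} (h : LoopRuns S M n T P x y) (hn : n ≤ n') :
    LoopRuns S M n' T P x y := by
  obtain ⟨t, ht, h⟩ := h
  exact ⟨t, ht.trans (Nat.mul_le_mul_right _ (by omega)), h⟩

/-- The loop returns a whole family in which any two distinct members may be picked. The remaining
level is the length of `l`. -/
theorem searchLoop {α : Type*} {e : α → Val K} {c : ℕ} (hS : SizeBound S c d) (hc : 1 ≤ c) :
    ∀ (l : List α) (L : List (List (Fin d → K))), l.length ≤ d → L.length = c ^ l.length + 1 →
      (∀ X ∈ L, X.length ≤ d + 1) → (∀ X ∈ L, X ≠ []) → (L.map listSpan).Nodup →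
      spanDim (spanSets L) ≤ l.length →
      ∃ L', LoopRuns S M l.length .head searchStep
          (.cons (.ofList (l.map e)) (.cons (.ofFam L) (.cons (.ofNat c) .nil)))
          (.cons .nil (.cons (.ofFam L') (.cons (.ofNat c) .nil))) ∧
        L' ⊆ L ∧ (L'.map listSpan).Nodup ∧ 2 ≤ L'.length ∧
        ∀ A ∈ spanSets L', ∀ B ∈ spanSets L', A ≠ B → MergePair c l.length (spanSets L) A B
  | [], L, _, hL, _, hne, hnd, hdim => by
    -- Level 0 is impossible: `c ^ 0 + 1 = 2` distinct nonempty subspaces cannot have a span of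
    -- dimension 0.
    have := spanDim_pos hne hnd (by simp [hL])
    simp at hdim
    omega
  | h :: l, L, hl, hL, hX, hne, hnd, hdim => by
    simp only [List.length_cons] at hl hL hdim
    have hpow : c ^ (l.length + 1) ≤ c ^ d := Nat.pow_le_pow_right hc hl
    obtain ⟨a, hr, ha⟩ := Runs.findPack (M := M) (x := .nil) (e := e) (l := l) hS hc (by omega)
      (by omega) hX hne
    have hr' : Runs S M (.call3 (.comp (var 0) .tail) (var 1) (var 2) findPack)
        (.cons (.ofList ((h :: l).map e)) (.cons (.ofFam L) (.cons (.ofNat c) .nil))) a :=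
      .call3 (Runs.var_zero.comp .tail) .var_one .var_two hr
    rcases ha with ⟨rfl, hnone⟩ | ⟨P, rfl, hlen, hsub, hP⟩
    -- If there is no pack, the counter is set to `nil`, which ends the loop with the current
    -- family.
    · refine ⟨L, ((LoopRuns.zero .head).succ .head (by simp [Val.ofList])
        (hr'.letIn (Runs.ite_nil .var_zero (Runs.nil.cons (Runs.var_two.cons
          (Runs.var_three.cons .nil)))))).mono (by simp), fun _ h => h, hnd, ?_, ?_⟩
      · have := Nat.one_le_pow (l.length + 1) c hc
        omega
      · exact fun A hA B hB hAB => .pick hnone hA hB hAB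
    · have hPL : P ⊆ L := fun X hX => List.mem_reverse.1 (hsub.subset hX)
      have hPnd : (P.map listSpan).Nodup := by
        refine List.Nodup.sublist (hsub.map _) ?_
        rwa [List.map_reverse, List.nodup_reverse]
      obtain ⟨L', hloop, hL', hnd', hlen', hpair⟩ := searchLoop (e := e) hS hc l P (by omega) hlen
        (fun X hX' => hX X (hPL hX')) (fun X hX' => hne X (hPL hX')) hPnd hP
      refine ⟨L', .succ .head (by simp [Val.ofList]) (hr'.letIn (Runs.ite_ne .var_zero ?_
        ((Runs.var_one.comp .tail).cons (Runs.var_zero.cons (Runs.var_three.cons .nil))))) hloop,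
        fun X hX => hPL (hL' hX), hnd', hlen', fun A hA B hB hAB => ?_⟩
      · rw [Val.ofFam, Ne, Val.ofList_eq_nil, List.map_eq_nil_iff]
        rintro rfl
        simp at hlen
      · exact .descend (spanSets_mono hPL) ((card_spanSets hPnd).trans hlen) hP (hpair A hA B hB hAB)

end Prog

theorem IsDecomposition.card_eq {K : Type*} [Field K] [Infinite K] {d : ℕ}
    {F F' : Finset (AffineSubspace K (Fin d → K))} {J : Set (Fin d → K)}
    (h : IsDecomposition F J) (h' : IsDecomposition F' J) : F.card = F'.card := by
  have := h.zLength_eq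
  rw [h'.zLength_eq] at this
  exact_mod_cast this.symm

theorem SizeBound.rounds_le {S c d : ℕ} (h : SizeBound S c d) :
    c ^ d * (c ^ d + 1) ^ d ≤ S := by
  refine le_trans ?_ h.pow_le
  calc c ^ d * (c ^ d + 1) ^ d ≤ (c ^ d + 1) * (c ^ d + 1) ^ d := Nat.mul_le_mul_right _ (Nat.le_succ _)
    _ = (c ^ d + 1) ^ (d + 1) := (pow_succ' _ _).symm
    _ ≤ _ := Nat.pow_le_pow_left (Nat.le_mul_of_pos_right _ (by omega)) _


/-! ### The programs for the algorithm -/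

namespace Prog

variable {K : Type*} [Field K] {S M : ℕ} {P Q T L A B C : Prog} {x y z a b w : Val K} {d : ℕ}
  {σ : Type*}

/-- The image under `N` of a member of the list `L` that is not contained in a member of `L`, if
there is one, for the environment `N, L`. -/
def findIn : Prog :=
  fold (var 1) nil (ite (var 1)
    (letIn (call2 (var 0) (var 2) image) (ite (any (var 4) (call2 (var 1) (var 0) spanLe)) (var 0) nil))
    (var 1))

/-- The image under a member of `E` of a member of the list `L` that is not contained in a member
of `L`, if there is one, for the environment `E, L`. -/
def find : Prog := fold (var 0) nil (ite (var 1) (call2 (var 0) (var 3) findIn) (var 1))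

/-- `Z` spans the image of a member of `L` under `N`, which is not contained in a member of `L`. -/
structure NewImage (L : List (List (Fin d → K))) (N : Matrix (Fin d) (Fin d) K)
    (Z : List (Fin d → K)) : Prop where
  length_le : Z.length ≤ d + 1
  ne_nil : Z ≠ []
  exists_eq : ∃ X ∈ L, listSpan Z = (listSpan X).vecMul N
  not_le : ∀ Y ∈ L, ¬ listSpan Z ≤ listSpan Y

theorem Runs.findIn {L : List (List (Fin d → K))} {N : Matrix (Fin d) (Fin d) K} (hd : d + 1 < S)
    (hL : L.length ≤ S) (hX : ∀ X ∈ L, X.length ≤ d + 1) (hne : ∀ X ∈ L, X ≠ []) :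
    ∃ a, Runs S M findIn (.cons (.ofMatrix N) (.cons (.ofFam L) x)) a ∧
      ((a = .nil ∧ ∀ X ∈ L, ∃ Y ∈ L, (listSpan X).vecMul N ≤ listSpan Y) ∨
        ∃ Z, a = .ofPts Z ∧ NewImage L N Z) := by
  refine Runs.fold_inv (e := Val.ofPts) (fun pre a =>
    (a = .nil ∧ ∀ X ∈ pre, ∃ Y ∈ L, (listSpan X).vecMul N ≤ listSpan Y) ∨
        ∃ Z, a = .ofPts Z ∧ NewImage L N Z) .var_one hL .nil (by simp) ?_
  rintro pre X a post hpre (⟨rfl, hI⟩ | ⟨Z, rfl, hZ⟩)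
  · have hXL : X ∈ L := by simp [hpre]
    have hlen := (hX X hXL).trans hd.le
    have himg := Runs.image (S := S) (M := M) (X := X) (N := N) (x := .nil) (by omega) hlen
    have hany := Runs.any (S := S) (M := M) (L := var 4) (B := .call2 (var 1) (var 0) .spanLe)
      (x := .cons (.ofPts (X.map fun x => x ᵥ* N))
        (.cons (.ofPts X) (.cons .nil (.cons (.ofMatrix N) (.cons (.ofFam L) x)))))
      (e := Val.ofPts) (l := L) .var_four hL fun Y hY => .call2 .var_one .var_zero
        (.spanLe (by omega) (by simpa using hlen) ((hX Y hY).trans hd.le))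
    rw [listSpan_map_vecMul] at hany
    by_cases hp : ∃ Y ∈ L, (listSpan X).vecMul N ≤ listSpan Y
    · refine ⟨_, Runs.ite_nil .var_one ((Runs.call2 .var_zero .var_two himg).letIn
        (Runs.ite_prop hany (fun h => absurd hp h) fun _ => .nil)), .inl ⟨rfl, ?_⟩⟩
      intro X' hX'
      rcases List.mem_append.1 hX' with hX' | hX'
      · exact hI X' hX'
      · rwa [List.mem_singleton.1 hX']
    · refine ⟨_, Runs.ite_nil .var_one ((Runs.call2 .var_zero .var_two himg).letIn
        (Runs.ite_prop hany (fun _ => .var_zero) fun h => absurd h hp)), .inr ⟨_, rfl, ?_, ?_, ?_, ?_⟩⟩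
      · simpa using hX X hXL
      · simpa using hne X hXL
      · exact ⟨X, hXL, listSpan_map_vecMul X N⟩
      · intro Y hY hle
        rw [listSpan_map_vecMul] at hle
        exact hp ⟨Y, hY, hle⟩
  · refine ⟨_, Runs.ite_ne .var_one ?_ .var_one, .inr ⟨Z, rfl, hZ⟩⟩
    rw [Val.ofPts, Ne, Val.ofList_eq_nil, List.map_eq_nil_iff]
    exact hZ.ne_nil

/-- The only loop over the alphabet. Its body is run with `M = 0`, so the number of matrices enters
as a single linear factor. -/
theorem Runs.find {L : List (List (Fin d → K))} {E : List (Matrix (Fin d) (Fin d) K)}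
    (hd : d + 1 < S) (hL : L.length ≤ S) (hX : ∀ X ∈ L, X.length ≤ d + 1)
    (hne : ∀ X ∈ L, X ≠ []) :
    ∃ a, Runs S E.length find (.cons (.ofList (E.map Val.ofMatrix)) (.cons (.ofFam L) x)) a ∧
      ((a = .nil ∧ ∀ N ∈ E, ∀ X ∈ L, ∃ Y ∈ L, (listSpan X).vecMul N ≤ listSpan Y) ∨
        ∃ N ∈ E, ∃ Z, a = .ofPts Z ∧ a ≠ .nil ∧ NewImage L N Z) := by
  refine Runs.fold_inv_outer (e := Val.ofMatrix) (fun pre a =>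
    (a = .nil ∧ ∀ N ∈ pre, ∀ X ∈ L, ∃ Y ∈ L, (listSpan X).vecMul N ≤ listSpan Y) ∨
        ∃ N ∈ E, ∃ Z, a = .ofPts Z ∧ a ≠ .nil ∧ NewImage L N Z) .var_zero .nil (by simp) ?_
  rintro pre N a post hpre (⟨rfl, hI⟩ | ⟨N', hN', Z, rfl, hnil, hZ⟩)
  · obtain ⟨a, h, ha⟩ := Runs.findIn (M := 0) (N := N) (x := .nil) hd hL hX hne
    refine ⟨a, Runs.ite_nil .var_one (.call2 .var_zero .var_three h), ?_⟩
    rcases ha with ⟨rfl, ha⟩ | ⟨Z, rfl, hZ⟩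
    · refine .inl ⟨rfl, fun N' hN' => ?_⟩
      rcases List.mem_append.1 hN' with hN' | hN'
      · exact hI N' hN'
      · rwa [List.mem_singleton.1 hN']
    · refine .inr ⟨N, by simp [hpre], Z, rfl, ?_, hZ⟩
      rw [Val.ofPts, Ne, Val.ofList_eq_nil, List.map_eq_nil_iff]
      exact hZ.ne_nil
  · exact ⟨_, Runs.ite_ne .var_one hnil .var_one, .inr ⟨N', hN', Z, rfl, hnil, hZ⟩⟩

/-- The subroutine REDUCE for the environment `L, c, l`, where the length of `l` is the dimension. -/
def reduce : Prog :=
  letIn (comp (cons (var 2) (cons (var 0) (cons (var 1) nil))) (comp (loop head searchStep) (var 1)))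
    (call2 (call1 (appendRev (comp (var 0) head) (comp (var 0) (comp tail head))) indep) (var 1)
      insertComp)

theorem Runs.reduce [Infinite K] {c : ℕ} (hS : SizeBound S c d) (hc : 1 ≤ c) {u : Fin d → K}
    {L : List (List (Fin d → K))} {F : Finset (AffineSubspace K (Fin d → K))}
    {J : Set (Fin d → K)} (hL : IsListing L F) (hF : IsDecomposition F J)
    (hcard : L.length = c ^ d + 1) :
    ∃ L' F' J', Runs S M reduce (.cons (.ofFam L) (.cons (.ofNat c) (.cons (.ofVec u) .nil)))
        (.ofFam L') ∧ IsListing L' F' ∧ IsDecomposition F' J' ∧ Reduce c J J' := by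
  classical
  have hd := hS.dim_lt
  have hne : ∀ X ∈ L, X ≠ [] := fun X hX => listSpan_nonempty_iff.1 (hF.nonempty _ (hL.mem hX))
  have hlen : ∀ X ∈ L, X.length ≤ d + 1 := fun X hX => hL.length_le hX
  -- The vector `u` serves only as a list of length `d`, which starts the level counter.
  obtain ⟨G, hloop, hGL, hGnd, hG2, hpair⟩ := searchLoop (M := M) (e := Val.atom) hS hc
    (List.ofFn u) L (by simp) (by simpa using hcard) hlen hne hL.nodup (by simpa using spanDim_le _)
  rw [← Val.ofVec_eq] at hloop
  obtain ⟨X, Y, G, rfl⟩ : ∃ X Y G', G = X :: Y :: G' := by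
    rcases G with _ | ⟨X, _ | ⟨Y, G⟩⟩
    · simp at hG2
    · simp at hG2
    · exact ⟨X, Y, G, rfl⟩
  have hXL : X ∈ L := hGL (by simp)
  have hYL : Y ∈ L := hGL (by simp)
  have hXY : listSpan X ≠ listSpan Y := by
    simp only [List.map_cons, List.nodup_cons, List.mem_cons, not_or] at hGnd
    exact hGnd.1.1
  have hXlen := hlen X hXL
  have hYlen := hlen Y hYL
  have hXYlen : (X.reverse ++ Y).length ≤ S := by
    have := hS.base_le
    have := Nat.one_le_pow d c hc
    rw [List.length_append, List.length_reverse]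
    nlinarith
  obtain ⟨W, hWr, hW, hWspan⟩ := Runs.indep (M := M) (x := .nil) (Nat.lt_of_succ_lt hd) hXYlen
  have hspan : listSpan W = affineSpan K ((listSpan X : Set (Fin d → K)) ∪ listSpan Y) := by
    rw [hWspan, AffineSubspace.span_union, AffineSubspace.affineSpan_coe,
      AffineSubspace.affineSpan_coe, ← AffineSubspace.span_union]
    exact congrArg (affineSpan K) (Set.ext fun y => by simp)
  obtain ⟨hdec, -⟩ := hF.merge (hL.mem hXL) (hL.mem hYL) hXY hspan
  refine ⟨_, _, _, Runs.letIn ((Runs.var_two.cons (Runs.var_zero.cons (Runs.var_one.cons .nil))).comp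
    ((hloop.runs (by simp; omega)).comp .var_one))
    (Runs.call2 (Runs.call1 (Runs.appendRev (e := Val.ofVec) (Runs.var_zero.comp .head)
      (Runs.var_zero.comp (Runs.tail.comp .head)) (by omega)) hWr) .var_one
      (Runs.insertComp (by omega) (hW.length_le.trans hd.le) (hcard ▸ hS.count_le)
        fun X hX => (hlen X hX).trans hd.le)),
    hL.insert_filter hW, hdec, ?_⟩
  refine ⟨spanSets L, listSpan X, listSpan Y, ?_, ?_, ?_⟩
  · rw [hF.zComponents_eq]
    ext A
    simp only [Finset.mem_coe, mem_spanSets, Set.mem_image, hL.mem_iff]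
    constructor
    · rintro ⟨X, hX, rfl⟩
      exact ⟨_, ⟨X, hX, rfl⟩, rfl⟩
    · rintro ⟨_, ⟨X, hX, rfl⟩, rfl⟩
      exact ⟨X, hX, rfl⟩
  · have := hpair (listSpan X) (mem_spanSets.2 ⟨X, by simp, rfl⟩) (listSpan Y)
      (mem_spanSets.2 ⟨Y, by simp, rfl⟩) fun h => hXY (SetLike.coe_injective h)
    simpa using this
  · rw [hspan]

/-- Add the component spanned by `Z` and apply REDUCE if necessary, for the environment
`Z, L, c, l`, where the length of `l` is the dimension. -/
def update : Prog :=
  letIn (call2 (call1 (var 0) indep) (var 1) insertComp)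
    (ite (drop (var 0) (call2 (var 3) (var 4) pow)) (var 0) (call3 (var 0) (var 3) (var 4) reduce))

theorem Runs.update [Infinite K] {c : ℕ} (hS : SizeBound S c d) (hc : 1 ≤ c)
    {R : WeightedAutomaton K σ d} {s : σ} {u : Fin d → K} {Z : List (Fin d → K)}
    {L : List (List (Fin d → K))} {F : Finset (AffineSubspace K (Fin d → K))}
    {J : Set (Fin d → K)} (hL : IsListing L F) (hF : IsDecomposition F J) (hcard : F.card ≤ c ^ d)
    (hJ : ¬ R.IsInvariant J) (hZ : NewImage L (R.transition s) Z) :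
    ∃ L' F' J', Runs S M update
        (.cons (.ofPts Z) (.cons (.ofFam L) (.cons (.ofNat c) (.cons (.ofVec u) .nil)))) (.ofFam L') ∧
      IsListing L' F' ∧ IsDecomposition F' J' ∧ AlgoStep R c J J' := by
  classical
  have hd := hS.dim_lt
  obtain ⟨X, hXL, hZX⟩ := hZ.exists_eq
  have hnot : ¬ (fun w => w ᵥ* R.transition s) '' (listSpan X : Set (Fin d → K)) ⊆ J := by
    -- By irreducibility, an image contained in `J` would lie in a single component.
    rw [← AffineSubspace.coe_vecMul, ← hZX, hF.subset_iff (listSpan_nonempty_iff.2 hZ.ne_nil)]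
    rintro ⟨A, hA, hle⟩
    obtain ⟨Y, hY, rfl⟩ := (hL.mem_iff A).1 hA
    exact hZ.not_le Y hY hle
  have hLS : L.length ≤ S := by
    rw [← hL.card_eq]
    exact hcard.trans ((Nat.le_succ _).trans hS.count_le)
  obtain ⟨W, hWr, hW, hWspan⟩ := Runs.indep (M := M) (x := .nil) (Nat.lt_of_succ_lt hd)
    (hZ.length_le.trans hd.le)
  have hdec := hF.insert_image (hL.mem hXL) hnot
  have hlist := hL.insert_filter hW
  rw [hWspan, hZX] at hlist
  have hrun : Runs S M (.call2 (.call1 (var 0) .indep) (var 1) .insertComp)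
      (.cons (.ofPts Z) (.cons (.ofFam L) (.cons (.ofNat c) (.cons (.ofVec u) .nil))))
      (.ofFam (W :: (L.filter fun X => ¬ listSpan X ≤ listSpan W).reverse)) :=
    Runs.call2 (.call1 .var_zero hWr) .var_one (.insertComp (by omega) (hW.length_le.trans hd.le) hLS
      fun X hX => (hL.length_le hX).trans hd.le)
  rw [hWspan, hZX] at hrun
  have hcard' : (insert ((listSpan X).vecMul (R.transition s))
      (F.filter fun A => ¬ A ≤ (listSpan X).vecMul (R.transition s))).card ≤ c ^ d + 1 :=
    (Finset.card_insert_le _ _).trans (Nat.succ_le_succ ((Finset.card_filter_le _ _).trans hcard))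
  generalize (W :: (L.filter fun Y => ¬ listSpan Y ≤
    (listSpan X).vecMul (R.transition s)).reverse) = L₁ at *
  generalize insert ((listSpan X).vecMul (R.transition s))
      (F.filter fun A => ¬ A ≤ (listSpan X).vecMul (R.transition s)) = F₁ at *
  have hX : (listSpan X : Set (Fin d → K)) ∈ zComponents J := by
    rw [hF.zComponents_eq]
    exact ⟨_, hL.mem hXL, rfl⟩
  have hlen := hdec.zLength_eq
  have hpow := Runs.pow (M := M) (S := S) (c := c) (x := .nil) (e := Val.atom) (l := List.ofFn u)
    (by simp; omega) hS.le fun j hj => hS.exp_le hc (by simpa using hj)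
  rw [← Val.ofVec_eq, List.length_ofFn] at hpow
  -- Dropping `c ^ d` entries leaves something exactly when there are more than `c ^ d` components.
  have hdrop := Runs.drop (S := S) (M := M) (L := var 0) (A := .call2 (var 3) (var 4) .pow)
    (x := .cons (.ofFam L₁) (.cons (.ofPts Z) (.cons (.ofFam L) (.cons (.ofNat c)
      (.cons (.ofVec u) .nil))))) (e := Val.ofPts) (l := L₁) (l' := List.replicate (c ^ d) ())
    (e' := fun _ => .nil) .var_zero (by rw [← Val.ofNat_eq]; exact .call2 .var_three .var_four hpow)
    (by simpa using hS.exp_le hc le_rfl)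
  rw [List.length_replicate] at hdrop
  by_cases hle : F₁.card ≤ c ^ d
  · refine ⟨L₁, F₁, _, hrun.letIn (Runs.ite_nil (hdrop.of_eq ?_) .var_zero), hlist, hdec, hJ, _, hX,
      s, hnot, .inl ⟨?_, rfl⟩⟩
    · rw [Val.ofList_eq_nil, List.map_eq_nil_iff, List.drop_eq_nil_iff, ← hlist.card_eq]
      exact hle
    · rw [hlen]
      exact_mod_cast hle
  · obtain ⟨L', F', J', hred, h1, h2, h3⟩ := Runs.reduce (M := M) (u := u) hS hc hlist hdec
      (by rw [← hlist.card_eq]; omega)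
    refine ⟨L', F', J', hrun.letIn (Runs.ite_ne hdrop ?_
      (.call3 .var_zero .var_three .var_four hred)), h1, h2, hJ, _, hX, s, hnot, .inr ⟨?_, h3⟩⟩
    · rw [Ne, Val.ofList_eq_nil, List.map_eq_nil_iff, List.drop_eq_nil_iff, ← hlist.card_eq]
      exact hle
    · rw [hlen]
      exact_mod_cast not_le.1 hle

/-- The representation of `{u}`, for the input of the algorithm. -/
def algoStart : Prog := cons (cons (var 1) nil) nil

/-- The loop condition: is there an image of a component that is not contained in `J`? -/
def algoGuard : Prog := call2 (comp head (var 2)) tail find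

/-- One iteration of the algorithm. -/
def algoBody : Prog :=
  cons head (letIn algoGuard (comp (cons (var 0) (cons (comp tail tail)
    (cons (comp (var 1) (var 0)) (cons (comp (var 1) (var 1)) nil)))) update))

theorem ofInput_eq {m c : ℕ} (e : Fin m ≃ σ) (R : WeightedAutomaton K σ d) :
    Val.ofInput e R c = .cons (.ofNat c) (.cons (.ofVec R.u) (.cons
      (.ofList ((List.ofFn fun i => R.transition (e i)).map Val.ofMatrix))
      (.cons (.ofVec R.v) .nil))) := by
  rw [List.map_ofFn]
  rfl

theorem Runs.algoStart {m c : ℕ} (e : Fin m ≃ σ) (R : WeightedAutomaton K σ d) :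
    Runs S M algoStart (Val.ofInput e R c) (.ofFam [[R.u]]) := by
  rw [ofInput_eq]
  exact (Runs.var_one.cons .nil).cons .nil

theorem isListing_singleton (u : Fin d → K) : IsListing [[u]] {affineSpan K {u}} where
  indep X hX := by
    rw [List.mem_singleton.1 hX]
    exact affineIndependent_get_nil.get_cons fun h =>
      listSpan_nonempty_iff.1 ⟨_, h⟩ rfl
  nodup := by simp
  mem_iff A := by
    have : listSpan [u] = affineSpan K {u} :=
      congrArg (affineSpan K) (Set.ext fun x => List.mem_singleton)
    simp [this, eq_comm]

/-! ### The guard, the body and the main loop -/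

section Iteration

variable [Infinite K] {c m : ℕ} {e : Fin m ≃ σ} {R : WeightedAutomaton K σ d}
  {L : List (List (Fin d → K))} {F : Finset (AffineSubspace K (Fin d → K))} {J : Set (Fin d → K)}

/-- Testing components suffices: if each image of a component lies in a component, the union is
stable; conversely an image contained in `J` lies in one component by irreducibility. -/
theorem Runs.algoGuard_cases (hS : SizeBound S c d) (hL : IsListing L F) (hF : IsDecomposition F J)
    (hcard : F.card ≤ c ^ d) (hu : R.u ∈ J) :
    ∃ a, Runs S m algoGuard (.cons (Val.ofInput e R c) (.ofFam L)) a ∧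
      ((a = .nil ∧ R.IsInvariant J) ∨ (a ≠ .nil ∧ ¬ R.IsInvariant J ∧
        ∃ s Z, a = .ofPts Z ∧ NewImage L (R.transition s) Z)) := by
  have hne : ∀ X ∈ L, X ≠ [] := fun X hX => listSpan_nonempty_iff.1 (hF.nonempty _ (hL.mem hX))
  obtain ⟨a, h, ha⟩ := Runs.find (S := S) (L := L) (E := List.ofFn fun i => R.transition (e i))
    (x := .nil) hS.dim_lt
    (by rw [← hL.card_eq]; exact hcard.trans ((Nat.le_succ _).trans hS.count_le))
    (fun X hX => hL.length_le hX) hne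
  rw [List.length_ofFn] at h
  refine ⟨a, ?_, ?_⟩
  · rw [ofInput_eq]
    exact .call2 (Runs.head.comp .var_two) .tail h
  · rcases ha with ⟨rfl, ha⟩ | ⟨N, hN, Z, rfl, hnil, hZ⟩
    · refine .inl ⟨rfl, hu, fun w hw s => ?_⟩
      rw [hF.eq_biUnion] at hw
      obtain ⟨A, hA, hw⟩ := Set.mem_iUnion₂.1 hw
      obtain ⟨X, hX, rfl⟩ := (hL.mem_iff A).1 hA
      obtain ⟨Y, hY, hle⟩ := ha (R.transition s) (List.mem_ofFn.2 ⟨e.symm s, by simp⟩) X hX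
      exact hF.subset (hL.mem hY) (hle ⟨w, hw, rfl⟩)
    · obtain ⟨i, rfl⟩ := List.mem_ofFn.1 hN
      refine .inr ⟨hnil, fun hinv => ?_, e i, Z, rfl, hZ⟩
      obtain ⟨X, hX, he⟩ := hZ.exists_eq
      have hsub : (listSpan Z : Set (Fin d → K)) ⊆ J := by
        rw [he]
        rintro _ ⟨w, hw, rfl⟩
        exact hinv.2 w (hF.subset (hL.mem hX) hw) _
      obtain ⟨A, hA, hle⟩ := (hF.subset_iff (listSpan_nonempty_iff.2 hZ.ne_nil)).1 hsub
      obtain ⟨Y, hY, rfl⟩ := (hL.mem_iff A).1 hA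
      exact hZ.not_le Y hY hle

theorem Runs.algoBody (hS : SizeBound S c d) (hc : 1 ≤ c) (hL : IsListing L F)
    (hF : IsDecomposition F J) (hcard : F.card ≤ c ^ d) (hu : R.u ∈ J) (hJ : ¬ R.IsInvariant J) :
    ∃ L' F' J', Runs S m algoBody (.cons (Val.ofInput e R c) (.ofFam L))
        (.cons (Val.ofInput e R c) (.ofFam L')) ∧
      IsListing L' F' ∧ IsDecomposition F' J' ∧ AlgoStep R c J J' := by
  obtain ⟨a, h, ⟨-, hinv⟩ | ⟨-, -, s, Z, rfl, hZ⟩⟩ :=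
    Runs.algoGuard_cases (e := e) hS hL hF hcard hu
  · exact absurd hinv hJ
  · obtain ⟨L', F', J', hup, h1, h2, h3⟩ := Runs.update (M := m) (u := R.u) hS hc hL hF hcard hJ hZ
    refine ⟨L', F', J', Runs.head.cons (h.letIn (Runs.comp (Runs.var_zero.cons
      ((Runs.tail.comp .tail).cons (Runs.cons ?_ (Runs.cons ?_ .nil)))) hup)), h1, h2, h3⟩
    · rw [ofInput_eq]
      exact Runs.var_one.comp .var_zero
    · rw [ofInput_eq]
      exact Runs.var_one.comp .var_one

/-- The budget `n` covers the distance from the current weight to its maximum. A step raises the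
weight without passing the maximum, so a budget of zero leaves no room for one. -/
theorem algoLoop (hS : SizeBound S c d) (hc : 1 ≤ c) : ∀ (n : ℕ) {L : List (List (Fin d → K))}
    {F : Finset (AffineSubspace K (Fin d → K))} {J : Set (Fin d → K)}, IsListing L F →
    IsDecomposition F J → F.card ≤ c ^ d → AlgoReachable R c J →
    c ^ d * (c ^ d + 1) ^ d ≤ chainWeight (c ^ d) F + n →
    ∃ L' F' J', LoopRuns S m n algoGuard algoBody (.cons (Val.ofInput e R c) (.ofFam L))
        (.cons (Val.ofInput e R c) (.ofFam L')) ∧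
      IsListing L' F' ∧ IsDecomposition F' J' ∧ AlgoReturns R c J' := by
  intro n L F J hL hF hcard hJ hn
  have hu := (hJ.invariants hc).2.1
  obtain ⟨a, h, ⟨rfl, hinv⟩ | ⟨hnil, hinv, -⟩⟩ := Runs.algoGuard_cases (e := e) hS hL hF hcard hu
  · exact ⟨L, F, J, (LoopRuns.zero h).mono n.zero_le, hL, hF, hJ, hinv⟩
  · obtain ⟨L', F', J', hr, hL', hF', hs⟩ := Runs.algoBody (e := e) hS hc hL hF hcard hu hinv
    obtain ⟨⟨F'', hF'', hcard'⟩, hss, -⟩ := hs.exists_isDecomposition hF hcard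
    rw [← hF'.card_eq hF''] at hcard'
    have hlt := hF.chainWeight_lt hF' hcard hss
    have hle := chainWeight_le hcard'
    cases n with
    | zero => omega
    | succ n =>
      obtain ⟨L₁, F₁, J₁, hloop, h₁⟩ := algoLoop hS hc n hL' hF' hcard' (hJ.tail hs) (by omega)
      exact ⟨L₁, F₁, J₁, .succ h hnil hr hloop, h₁⟩

theorem Runs.whileProg (hS : SizeBound S c d) (hc : 1 ≤ c) :
    ∃ z J, Runs S m (_root_.whileProg Prog.algoStart Prog.algoGuard Prog.algoBody) (Val.ofInput e R c) z ∧
      Represents z J ∧ AlgoReturns R c J := by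
  obtain ⟨L', F', J', hloop, hL, hF, hJ⟩ := algoLoop (e := e) (R := R) hS hc
    (c ^ d * (c ^ d + 1) ^ d) (isListing_singleton R.u) (.singleton R.u)
    (by simpa using Nat.one_le_pow _ _ hc) .refl (Nat.le_add_left _ _)
  refine ⟨_, J', Runs.comp ((Runs.skip.cons (.algoStart e R)).comp (hloop.runs hS.rounds_le)) .tail,
    (represents_iff hF).2 ⟨L', rfl, hL⟩, hJ⟩

end Iteration

end Prog

/-! ### The running time -/

/-- The size bound `max c 2 ^ ((2 d + 2) (d + 1))`. -/
theorem sizeBound_pow {c d : ℕ} (hc : 1 ≤ c) :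
    SizeBound (max c 2 ^ ((2 * d + 2) * (d + 1))) c d := by
  set X := max c 2
  have hcX : c ≤ X := le_max_left _ _
  have hX : 2 ≤ X := le_max_right _ _
  constructor
  · exact hcX.trans (Nat.le_self_pow (by positivity) X)
  · rw [pow_mul]
    refine Nat.pow_le_pow_left ?_ _
    -- As `X ≥ 2`, one extra factor `X` at least doubles `X ^ d`, which pays for the summand 1.
    have h1 : c ^ d + 1 ≤ X ^ (d + 1) := by
      have := Nat.pow_le_pow_left hcX d
      have := Nat.one_le_pow d X (by omega)
      rw [pow_succ]
      nlinarith
    have h2 : d + 2 ≤ X ^ (d + 1) :=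
      (Nat.lt_two_pow_self (n := d + 1)).trans_le (Nat.pow_le_pow_left hX _)
    calc (c ^ d + 1) * (d + 2) ≤ X ^ (d + 1) * X ^ (d + 1) := Nat.mul_le_mul h1 h2
      _ = X ^ (2 * d + 2) := by rw [← pow_add]; congr 1; ring

theorem theorem5p1 :
    ∃ (p : Polynomial ℕ) (C : ℕ) (start guard body : Prog),
      ∀ (K : Type*) [Field K] [Infinite K] (σ : Type*) (m : ℕ) (e : Fin m ≃ σ) (d : ℕ)
        (R : WeightedAutomaton K σ d) (c : ℕ), 1 ≤ c →
        -- correctness: whatever is returned is a Z-affine invariant contained in `I_c(R)`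
        (∀ J, AlgoReturns R c J →
          IsZAffine J ∧ R.IsInvariant J ∧ J ⊆ invariantMeet R c) ∧
        -- no execution gets stuck: a value that is not returned has a successor
        (∀ J, AlgoReachable R c J → ¬ R.IsInvariant J → ∃ J', AlgoStep R c J J') ∧
        -- termination: the number of iterations is bounded, for all choices
        (∀ (n : ℕ) (J : ℕ → Set (Fin d → K)), J 0 = {R.u} →
          (∀ i < n, AlgoStep R c (J i) (J (i + 1))) → n ≤ C * max c 2 ^ p.eval d) ∧
        -- running time: one fixed program carries out the algorithm within the bound
        Implements start guard body e R c ∧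
        ∃ (z : Val K) (t : ℕ) (J : Set (Fin d → K)),
          (whileProg start guard body).Eval (Val.ofInput e R c) z t ∧
          t ≤ C * (m + 1) * max c 2 ^ p.eval d ∧
          Represents z J ∧ AlgoReturns R c J := by
  obtain ⟨D, hD⟩ : ∃ D, D = (whileProg Prog.algoStart Prog.algoGuard Prog.algoBody).deg := ⟨_, rfl⟩
  -- With `q = (2 d + 2) (d + 1)` the size bound is `X ^ q`, and `X ^ q + 2 ≤ X ^ (q + 2)` is raised
  -- to the degree `D` of the program. Taking `D + 1` makes the same exponent dominate the iteration
  -- bound `X ^ q` without knowing that `D` is positive.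
  refine ⟨((2 * .X + 2) * (.X + 1) + 2) * ((D + 1 : ℕ) : Polynomial ℕ), 1, Prog.algoStart,
    Prog.algoGuard, Prog.algoBody, ?_⟩
  intro K _ _ σ m e d R c hc
  have hp : (((2 * .X + 2) * (.X + 1) + 2) * ((D + 1 : ℕ) : Polynomial ℕ)).eval d =
      ((2 * d + 2) * (d + 1) + 2) * (D + 1) := by
    rw [Polynomial.eval_mul, Polynomial.eval_natCast]
    simp
  rw [hp]
  have hS := sizeBound_pow (d := d) hc
  set X := max c 2
  have hX : 2 ≤ X := le_max_right _ _
  set q := (2 * d + 2) * (d + 1)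
  have hstep : ∀ J, AlgoReachable R c J → ∃ F, IsDecomposition F J ∧ F.card ≤ c ^ d ∧ R.u ∈ J :=
    fun J hJ => by
      obtain ⟨⟨F, hF, hcard⟩, hu, -⟩ := hJ.invariants hc
      exact ⟨F, hF, hcard, hu⟩
  refine ⟨?_, ?_, ?_, ⟨?_, ?_⟩, ?_⟩
  · rintro J ⟨hJ, hinv⟩
    obtain ⟨⟨F, hF, -⟩, -, hI⟩ := hJ.invariants hc
    exact ⟨hF.isZAffine, hinv, hI⟩
  · intro J hJ hinv
    obtain ⟨F, hF, hcard, hu⟩ := hstep J hJ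
    -- A successor is exhibited by running the body program on some representation of `J`.
    obtain ⟨z, hz⟩ := hF.exists_represents
    obtain ⟨L, rfl, hL⟩ := (represents_iff hF).1 hz
    obtain ⟨_, _, J', -, -, -, h⟩ := Prog.Runs.algoBody (e := e) hS hc hL hF hcard hu hinv
    exact ⟨J', h⟩
  · intro n J h0 hJ
    rw [one_mul]
    refine (iterations_le hc h0 hJ).trans (hS.rounds_le.trans (Nat.pow_le_pow_right (by omega) ?_))
    nlinarith [Nat.zero_le D, Nat.zero_le q, Nat.zero_le (q * D)]
  · obtain ⟨t, -, h⟩ := Prog.Runs.algoStart (S := 0) (M := 0) (c := c) e R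
    exact ⟨_, t, h, (represents_iff (.singleton R.u)).2 ⟨_, rfl, Prog.isListing_singleton R.u⟩⟩
  · intro J z hJ hz
    obtain ⟨F, hF, hcard, hu⟩ := hstep J hJ
    obtain ⟨L, rfl, hL⟩ := (represents_iff hF).1 hz
    constructor
    · obtain ⟨a, ⟨t, -, h⟩, ha⟩ := Prog.Runs.algoGuard_cases (e := e) hS hL hF hcard hu
      exact ⟨a, t, h, by rcases ha with ha | ha <;> simp [ha]⟩
    · intro hinv
      obtain ⟨L', F', J', ⟨t, -, h⟩, hL', hF', hs⟩ :=
        Prog.Runs.algoBody (e := e) hS hc hL hF hcard hu hinv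
      exact ⟨_, J', t, h, hs, (represents_iff hF').2 ⟨L', rfl, hL'⟩⟩
  · obtain ⟨z, J, ⟨t, ht, h⟩, hz, hJ⟩ := Prog.Runs.whileProg (e := e) (R := R) hS hc
    refine ⟨z, t, J, h, ht.trans ?_, hz, hJ⟩
    rw [one_mul, ← hD]
    refine Nat.mul_le_mul_left _ ?_
    -- Since `X ^ 2 ≥ 4` and `X ^ q ≥ 1`, the product is at least `4 * X ^ q`.
    have h2 : X ^ q + 2 ≤ X ^ (q + 2) := by
      have := Nat.one_le_pow q X (by omega)
      have := Nat.mul_le_mul_left (X ^ q) (Nat.pow_le_pow_left hX 2)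
      rw [pow_add]
      omega
    refine (Nat.pow_le_pow_left h2 D).trans ?_
    rw [← pow_mul]
    exact Nat.pow_le_pow_right (by omega) (Nat.mul_le_mul_left _ (Nat.le_succ D))
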